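/- Consider a periodic chain of $2L$ qudits of local dimension $q\ge 2$ with lattice spacing $1/2$ (positions in $\tfrac12\mathbb Z$ modulo $L$). A brickwork circuit evolves it in discrete time by $\mathbb U(\tau)=\prod_{x\in\mathbb Z_L+1/2}U(x,\tau+\tfrac12)_x\prod_{x\in\mathbb Z_L}U(x,\tau)_x$, where $U(x,\cdot)_x$ acts as $U(x,\cdot)$ on the qudits at $x$ and $x+\tfrac12$ and as the identity elsewhere. In a random permutation circuit the gates are independent, and each is the permutation matrix of a uniformly random permutation of the $q^2$ product basis states $|s,r\rangle$ of two qudits; write $\langle\cdot\rangle_{\rm RPC}$ for the average. For traceless $q\times q$ matrices $\mathcal O_\mu,\mathcal O_\nu$ (in particular for traceless Hermitian ones with $\operatorname{tr}[\mathcal O\mathcal O^\dagger]=q$) let $$C_{\mu\nu}(x,t)=\frac{\operatorname{tr}[\mathcal O_\mu(x,t)\,\mathcal O_\nu(0,0)]}{\operatorname{tr}\mathbb 1},\qquad \mathcal O_\mu(x,t)=\mathcal U_t^\dagger\,\mathcal O_\mu(x,0)\,\mathcal U_t,\quad \mathcal U_t=\mathbb U(t-1)\cdots\mathbb U(0),$$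 where $\mathcal O(x,0)$ acts as $\mathcal O$ at position $x$ and as the identity elsewhere, and let $o_\mu=q^{-3/2}\sum_{i,j}\langle i|\mathcal O_\mu|j\rangle$. Put $\alpha=1+\frac1q$ and, for integers $x,y$, $$A_{x,y}(z)=\sum_{s=1}^{y}\binom{x-1+y-s}{x-1}z^s+\delta_{x,0}\delta_{y,0},$$ with an empty sum for $y\le 0$ and the conventions $\binom{-1}{-1}=1$, $\binom{n}{-1}=0$ for $n\ge 0$ (so that $A_{0,y}(z)=z^y$ for $y\ge0$). (a) For all integers $t\ge 1$, $L\ge 2t$ and all integers $x$ with $-L/2<x\le L/2$, $$\langle C_{\mu\nu}(x,t)\rangle_{\rm RPC}=\frac{o_\mu o_\nu}{1-q^{-2}}\left[\frac{\sqrt q}{1+q}\right]^{4t}\Bigl(A_{t-x+1,t+x}(\alpha)A_{t+x-1,t-x+1}(\alpha)-A_{t-x+1,t+x-1}(\alpha)A_{t+x,t-x+1}(\alpha)\Bigr).$$ (b) Let $\mathcal Q=\frac1{(q^2)!}\sum_U U\otimes U$ be the averaged two-copy gate, the sum being over the permutation matrices $U$ of the two-qudit basis, and let $|\circ\rangle=q^{-1/2}\sum_s|s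 s\rangle$, $|\flat\rangle=q^{-1}\sum_{s,r}|s r\rangle$ be states of two copies of a qudit. For $x,y\ge1$ let $w_1(x,y)$ be the tensor network formed by $x\times y$ copies of $\mathcal Q$, labelled $(i,j)$ with $0\le i<x$, $0\le j<y$, where the upper left output of $(i,j)$ is the lower right input of $(i,j+1)$ and the upper right output of $(i,j)$ is the lower left input of $(i+1,j)$. The free lower right input of $(0,0)$ and the free upper left output of $(x-1,y-1)$ are contracted with $|\flat\rangle$, and all other free legs with $|\circ\rangle$. Then, for all $x,y\ge 1$, $$w_1(x,y)=\frac1q+\frac{q^2-1}{q}\left(\frac{\sqrt q}{1+q}\right)^{2x+2y}\bigl[A_{x,y}(\alpha)A_{y-1,x}(\alpha)-A_{x,y-1}(\alpha)A_{y,x}(\alpha)\bigr].$$ -/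

import Mathlib

open scoped BigOperators Matrix

noncomputable section

namespace RPC

/-! ### The circuit

The chain has `2 * L` qudits of dimension `q`, with lattice spacing `1/2` and periodic boundary
conditions. The site with index `n : ZMod (2 * L)` sits at position `n / 2`. -/

/-- Labels of the computational basis of the chain. -/
abbrev Config (q L : ℕ) : Type := ZMod (2 * L) → Fin q

/-- A permutation of the two-qudit computational basis. -/
abbrev GatePerm (q : ℕ) : Type := Equiv.Perm (Fin q × Fin q)

/-- The permutation unitary `U |s,r⟩ = |f(s,r)⟩` of two qudits. -/
def gateMatrix (R : Type*) [Zero R] [One R] {q : ℕ} (f : GatePerm q) :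
    Matrix (Fin q × Fin q) (Fin q × Fin q) R :=
  Matrix.of fun a b => if f b = a then 1 else 0

/-- The one-qudit operator `O` acting at site `n`, and as the identity elsewhere. -/
def oneSite {q L : ℕ} [NeZero L] (n : ZMod (2 * L)) (O : Matrix (Fin q) (Fin q) ℂ) :
    Matrix (Config q L) (Config q L) ℂ :=
  Matrix.of fun s s' => if ∀ m, m ≠ n → s m = s' m then O (s n) (s' n) else 0

/-- The two-qudit operator `M` acting at the sites `n` and `n + 1` (in this order), and as the
identity elsewhere. -/
def twoSite {q L : ℕ} [NeZero L] (n : ZMod (2 * L))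
    (M : Matrix (Fin q × Fin q) (Fin q × Fin q) ℂ) :
    Matrix (Config q L) (Config q L) ℂ :=
  Matrix.of fun s s' =>
    if ∀ m, m ≠ n → m ≠ n + 1 → s m = s' m then M (s n, s (n + 1)) (s' n, s' (n + 1)) else 0

/-- The gates of a brickwork circuit with `t` time steps: `G (τ, 0, j)` is the gate `U(j, τ)`
and `G (τ, 1, j)` is the gate `U(j + 1/2, τ + 1/2)`. -/
abbrev Circuit (q L t : ℕ) : Type := Fin t × Fin 2 × Fin L → GatePerm q

/-- One of the two half-steps of a time step (`h = 0`: gates at integer positions `j`, i.e. on the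
sites `2j, 2j+1`; `h = 1`: gates at positions `j + 1/2`, i.e. on the sites `2j+1, 2j+2`).
The factors commute, since they act on disjoint pairs of sites. -/
def halfStep {q L : ℕ} [NeZero L] (h : Fin 2) (g : Fin L → GatePerm q) :
    Matrix (Config q L) (Config q L) ℂ :=
  (List.ofFn fun j : Fin L =>
    twoSite ((2 * (j : ℕ) + (h : ℕ) : ℕ) : ZMod (2 * L)) (gateMatrix ℂ (g j))).prod

/-- The evolution operator `𝕌(τ)` of one time step. -/
def timeStep {q L t : ℕ} [NeZero L] (G : Circuit q L t) (τ : Fin t) :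
    Matrix (Config q L) (Config q L) ℂ :=
  halfStep 1 (fun j => G (τ, 1, j)) * halfStep 0 (fun j => G (τ, 0, j))

/-- The evolution operator `𝕌(t-1) ⋯ 𝕌(1) 𝕌(0)` of `t` time steps. -/
def evolution {q L t : ℕ} [NeZero L] (G : Circuit q L t) :
    Matrix (Config q L) (Config q L) ℂ :=
  (List.ofFn fun τ : Fin t => timeStep G τ).reverse.prod

/-- The Heisenberg-picture operator `O(x, t)`, for an integer position `x`. -/
def heisenberg {q L t : ℕ} [NeZero L] (G : Circuit q L t) (O : Matrix (Fin q) (Fin q) ℂ) (x : ℤ) :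
    Matrix (Config q L) (Config q L) ℂ :=
  (evolution G)ᴴ * oneSite ((2 * x : ℤ) : ZMod (2 * L)) O * evolution G

/-- The infinite-temperature two-point function `tr[Oμ(x,t) Oν(0,0)] / tr 1` of a circuit. -/
def corr {q L t : ℕ} [NeZero L] (G : Circuit q L t) (Oμ Oν : Matrix (Fin q) (Fin q) ℂ) (x : ℤ) :
    ℂ :=
  (heisenberg G Oμ x * oneSite 0 Oν).trace /
    (1 : Matrix (Config q L) (Config q L) ℂ).trace

/-- The average of the two-point function over random permutation circuits, i.e. over independent
gates, each of them uniformly distributed on the permutations of the `q ^ 2` basis states. -/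
def avgCorr (q L t : ℕ) [NeZero L] (Oμ Oν : Matrix (Fin q) (Fin q) ℂ) (x : ℤ) : ℂ :=
  (∑ G : Circuit q L t, corr G Oμ Oν x) / (Fintype.card (Circuit q L t) : ℂ)

/-- The rescaled sum of matrix elements `o = q^{-3/2} ∑ᵢⱼ ⟨i|O|j⟩`. -/
def opSum {q : ℕ} (O : Matrix (Fin q) (Fin q) ℂ) : ℂ :=
  (((q : ℝ) ^ (-(3 / 2) : ℝ) : ℝ) : ℂ) * ∑ i, ∑ j, O i j

/-! ### The folded tensor network -/

/-- Basis labels of a folded leg, i.e. of two copies of a qudit. -/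
abbrev Leg (q : ℕ) : Type := Fin q × Fin q

/-- The circle state `q^{-1/2} ∑ₛ |s s⟩`. -/
def circ {q : ℕ} (s : Leg q) : ℝ := if s.1 = s.2 then 1 / Real.sqrt q else 0

/-- The flat state `q^{-1} ∑ₛᵣ |s r⟩`. -/
def flat {q : ℕ} (_ : Leg q) : ℝ := 1 / (q : ℝ)

/-- The matrix elements of the averaged two-copy gate `(1/(q²)!) ∑_U U ⊗ U`; the arguments are
the (left, right) outgoing legs and the (left, right) incoming legs. -/
def avgGate {q : ℕ} (out inp : Leg q × Leg q) : ℝ :=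
  (∑ f : GatePerm q,
    gateMatrix ℝ f (out.1.1, out.2.1) (inp.1.1, inp.2.1) *
      gateMatrix ℝ f (out.1.2, out.2.2) (inp.1.2, inp.2.2)) / (Nat.factorial (q ^ 2) : ℝ)

/-- The tensor network `w_k(x, y)`: a rectangle, rotated by 45 degrees, of averaged gates `(i, j)`,
`i < x`, `j < y`, where `i` grows towards the upper right and `j` towards the upper left. The label
`e i j` sits on the lower right leg of gate `(i, j)`, which is the upper left leg of gate
`(i, j - 1)`; the label `f i j` sits on the lower left leg of gate `(i, j)`, which is the upper
right leg of gate `(i - 1, j)`. Of the legs on the lower right side, the first `k` carry flat states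
and the other `x - k` carry circle states. The topmost leg of the upper left side carries a flat
state. All other outer legs carry circle states. All labels are summed over. -/
def w (q k x y : ℕ) : ℝ :=
  ∑ e : Fin x → Fin (y + 1) → Leg q, ∑ f : Fin (x + 1) → Fin y → Leg q,
    (∏ i : Fin x, ∏ j : Fin y,
      avgGate (e i j.succ, f i.succ j) (f i.castSucc j, e i j.castSucc)) *
    (∏ i : Fin x, if (i : ℕ) < k then flat (e i 0) else circ (e i 0)) *
    (∏ j : Fin y, circ (f 0 j)) *
    (∏ i : Fin x, if (i : ℕ) + 1 = x then flat (e i (Fin.last y)) else circ (e i (Fin.last y))) *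
    (∏ j : Fin y, circ (f (Fin.last x) j))

/-! ### The functions in the solution -/

/-- The binomial coefficient of two integers: the generalized binomial coefficient for `k ≥ 0`,
and `binom n k = binom n (n - k)` for `k < 0` (which is `0` when `k > n` or `n ≥ 0`). In particular
`binom (-1) (-1) = 1`, and `binom n (-1) = 0` for `n ≥ 0`. -/
def binom (n k : ℤ) : ℤ :=
  if 0 ≤ k then Ring.choose n k.toNat else if k ≤ n then Ring.choose n (n - k).toNat else 0

/-- `A_{x,y}(z) = ∑_{s=1}^{y} binom(x-1+y-s, x-1) z^s + δ_{y,0} δ_{x,0}`. -/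
def A (x y : ℤ) (z : ℝ) : ℝ :=
  (∑ s ∈ Finset.Icc 1 y, (binom (x - 1 + y - s) (x - 1) : ℝ) * z ^ s) +
    if y = 0 ∧ x = 0 then 1 else 0

/-- `α = 1 + 1/q`. -/
def α (q : ℕ) : ℝ := 1 + 1 / (q : ℝ)

end RPC

end

namespace RPC

/-! ### Averages over permutations -/

section PermAverage

variable {K : Type*} [Field K] {X : Type*} [Fintype X] [DecidableEq X]

/-! Expanding the trace, the two matrix indices become two copies of the chain driven by the same
random permutations, and what matters is where the copies agree. The averaged gate acts simply on
the indicator `agree K S` of agreement outside `S`. It fixes the indicator unless exactly one of its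
wires lies in `S`; in that case it deletes both wires from `S` with weight `q/(1+q)` and adds both
with weight `1/(1+q)` (`avgAct_agree_of_cut`). Read backwards in time, an interval thus stays an
interval, and its two ends perform independent biased walks until they meet.

When the ends meet the interval is empty, and its indicator vanishes if the copies differ somewhere.
Such annihilating walks are solved by a two-by-two determinant in the spirit of Karlin and McGregor
(`ringRun_agree_arc`). Let `f` be the probability that a left end finishes to the left of site `0`,
and `g` the probability that a right end finishes to its right. The value is `f u * g v - q^(v-u) *
(g u * f v)`. The two ends drift in opposite directions, and the power of `q` repairs this: `q^(-u)
* g u` obeys the recursion of the left end, and `q^v * f v` that of the right end. The expression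
vanishes at `u = v` and has the correct initial values.

The one-end probabilities are binomial tails (`tail`). Stripped of their power weights they satisfy
Pascal's rule, whose solution is `A`; the argument `α`, the inverse of `q/(1+q)`, encodes the
boundary value `1`. Pascal's rule also brings the determinant into the stated form (`tail_det`).

For (a), a traceless operator hit by an averaged gate acts as a multiple of `agree {y} - agree ∅`
(`ringRun_opAgree`), so the correlation is a constant times the probability that a single difference
at site `0` becomes a single difference at site `2 * x`. For (b), the same walk is run column by
column. The flat state at the lower corner weights an interval by `q` if it contains the corner slot
and by `1` otherwise, which gives `1 + (q - 1)` times the determinant (`columns_colRun_agree`). -/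

theorem sum_perm_apply (h : X → K) (a : X) :
    (Fintype.card X : K) * ∑ f : Equiv.Perm X, h (f a) =
      (Fintype.card (Equiv.Perm X) : K) * ∑ c, h c := by
  have key : ∀ b : X, ∑ f : Equiv.Perm X, h (f b) = ∑ f : Equiv.Perm X, h (f a) := fun b =>
    Fintype.sum_equiv (Equiv.mulRight (Equiv.swap a b)) _ _ (by simp)
  calc (Fintype.card X : K) * ∑ f : Equiv.Perm X, h (f a)
      = ∑ b : X, ∑ f : Equiv.Perm X, h (f b) := by simp [key]
    _ = ∑ f : Equiv.Perm X, ∑ c, h c := by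
        rw [Finset.sum_comm]
        exact Finset.sum_congr rfl fun f _ => Equiv.sum_comp f h
    _ = _ := by simp

/-- The symmetric group is doubly transitive, so all ordered pairs of distinct points give the same
sum; adding these up and reindexing by each permutation gives the right-hand side. -/
theorem sum_perm_apply₂ (h : X → X → K) {a b : X} (hab : a ≠ b) :
    ((Fintype.card X : K) * ((Fintype.card X : K) - 1)) * ∑ f : Equiv.Perm X, h (f a) (f b) =
      (Fintype.card (Equiv.Perm X) : K) * ∑ c, ∑ d, if c = d then 0 else h c d := by
  have key : ∀ c d : X, c ≠ d →
      ∑ f : Equiv.Perm X, h (f c) (f d) = ∑ f : Equiv.Perm X, h (f a) (f b) := by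
    intro c d hcd
    obtain ⟨π, h1, h2⟩ : ∃ π : Equiv.Perm X, π a = c ∧ π b = d := by
      -- The first swap sends `a` to `c` and `b` to some point other than `c`; the second moves that
      -- point to `d` and leaves `c` alone.
      refine ⟨Equiv.swap (Equiv.swap a c b) d * Equiv.swap a c, ?_, ?_⟩
      · rw [Equiv.Perm.mul_apply, Equiv.swap_apply_left, Equiv.swap_apply_of_ne_of_ne _ hcd]
        intro h
        have := congrArg (Equiv.swap a c) h
        simp at this
        exact hab this
      · simp
    exact Fintype.sum_equiv (Equiv.mulRight π) _ _ (by simp [h1, h2])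
  have e1 : ∑ c : X, ∑ d, (if c = d then 0 else ∑ f : Equiv.Perm X, h (f c) (f d)) =
      ((Fintype.card X : K) * ((Fintype.card X : K) - 1)) *
        ∑ f : Equiv.Perm X, h (f a) (f b) := by
    have : ∀ c : X, ∑ d, (if c = d then 0 else ∑ f : Equiv.Perm X, h (f c) (f d)) =
        ((Fintype.card X : K) - 1) * ∑ f : Equiv.Perm X, h (f a) (f b) := by
      intro c
      set T := ∑ f : Equiv.Perm X, h (f a) (f b) with hT
      have : ∀ d, (if c = d then 0 else ∑ f : Equiv.Perm X, h (f c) (f d)) =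
          T - (if c = d then T else 0) := by
        intro d
        split_ifs with hcd
        · simp
        · rw [key c d hcd, sub_zero]
      simp only [this, Finset.sum_sub_distrib, Finset.sum_const, Finset.sum_ite_eq,
        Finset.mem_univ, if_true, Finset.card_univ, nsmul_eq_mul]
      ring
    simp only [this, Finset.sum_const, Finset.card_univ, nsmul_eq_mul]
    ring
  have e2 : ∑ c : X, ∑ d, (if c = d then 0 else ∑ f : Equiv.Perm X, h (f c) (f d)) =
      ∑ f : Equiv.Perm X, ∑ c : X, ∑ d, (if c = d then 0 else h c d) := by
    have : ∀ c d : X, (if c = d then 0 else ∑ f : Equiv.Perm X, h (f c) (f d)) =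
        ∑ f : Equiv.Perm X, if f c = f d then 0 else h (f c) (f d) := by
      intro c d
      split_ifs with hcd <;> simp [hcd]
    simp only [this]
    calc _ = ∑ c : X, ∑ f : Equiv.Perm X, ∑ d, (if f c = f d then 0 else h (f c) (f d)) :=
          Finset.sum_congr rfl fun c _ => Finset.sum_comm
      _ = ∑ f : Equiv.Perm X, ∑ c : X, ∑ d, (if f c = f d then 0 else h (f c) (f d)) :=
          Finset.sum_comm
      _ = _ := by
          refine Finset.sum_congr rfl fun f _ => ?_
          rw [← Equiv.sum_comp f (fun c => ∑ d, if c = d then 0 else h c d)]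
          refine Finset.sum_congr rfl fun c _ => ?_
          rw [← Equiv.sum_comp f (fun d => if f c = d then 0 else h (f c) d)]
  rw [← e1, e2]
  simp

end PermAverage

/-! ### The averaged gate as an operator on observables of two copies -/

section GateAverage

variable {K : Type*} [Field K] {q : ℕ}

/-- The mean over the permutations `f` of `h (f a).1 (f b).1`, restricted to the event
`(f a).2 = (f b).2`. -/
theorem mean_perm_fst [CharZero K] (hq : 2 ≤ q) (h : Fin q → Fin q → K) (a b : Fin q × Fin q) :
    (∑ f : GatePerm q, if (f a).2 = (f b).2 then h (f a).1 (f b).1 else 0) /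
        (Fintype.card (GatePerm q) : K) =
      if a = b then (∑ i, h i i) / q
      else (∑ i, ∑ j, if i = j then 0 else h i j) / (q * ((q : K) ^ 2 - 1)) := by
  have hq0 : (q : K) ≠ 0 := by
    have : q ≠ 0 := by omega
    exact_mod_cast this
  have hq1 : (q : K) ^ 2 - 1 ≠ 0 := by
    have : q ^ 2 ≠ 1 := by nlinarith
    rw [sub_ne_zero]
    exact_mod_cast this
  have hN : (Fintype.card (GatePerm q) : K) ≠ 0 := by
    exact_mod_cast Fintype.card_ne_zero
  split_ifs with hab
  · subst hab
    have := sum_perm_apply (K := K) (fun c : Fin q × Fin q => h c.1 c.1) a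
    simp only [Fintype.sum_prod_type, Fintype.card_prod, Fintype.card_fin, Finset.sum_const,
      Finset.card_univ, nsmul_eq_mul, ← Finset.mul_sum] at this
    simp only [if_true]
    push_cast at this
    rw [div_eq_div_iff hN hq0]
    have h2 : (q : K) * ((∑ f : GatePerm q, h (f a).1 (f a).1) * q) =
        q * ((∑ i, h i i) * (Fintype.card (GatePerm q) : K)) := by
      linear_combination this
    exact mul_left_cancel₀ hq0 h2
  · have := sum_perm_apply₂ (K := K)
      (fun c d : Fin q × Fin q => if c.2 = d.2 then h c.1 d.1 else 0) hab
    -- Distinct inputs have distinct outputs. If the second components of the outputs coincide, the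
    -- first ones differ, and the `q` possible common values give the factor `q`.
    have e : ∑ c : Fin q × Fin q, ∑ d : Fin q × Fin q,
        (if c = d then 0 else if c.2 = d.2 then h c.1 d.1 else 0) =
        q * ∑ i, ∑ j, if i = j then 0 else h i j := by
      simp only [Fintype.sum_prod_type]
      have : ∀ i k : Fin q, ∑ j, ∑ l, (if (i, k) = (j, l) then 0 else
          if k = l then h i j else 0) = ∑ j, if i = j then 0 else h i j := by
        intro i k
        refine Finset.sum_congr rfl fun j _ => ?_
        rw [Finset.sum_eq_single k]
        · simp
        · intro l _ hl
          simp [Ne.symm hl]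
        · simp
      simp only [this, Finset.sum_const, Finset.card_univ, Fintype.card_fin, nsmul_eq_mul,
        Finset.mul_sum]
    rw [e, Fintype.card_prod, Fintype.card_fin] at this
    push_cast at this
    rw [div_eq_div_iff hN (mul_ne_zero hq0 hq1)]
    refine mul_left_cancel₀ hq0 ?_
    linear_combination this

theorem mean_perm_snd [CharZero K] (hq : 2 ≤ q) (h : Fin q → Fin q → K) (a b : Fin q × Fin q) :
    (∑ f : GatePerm q, if (f a).1 = (f b).1 then h (f a).2 (f b).2 else 0) /
        (Fintype.card (GatePerm q) : K) =
      if a = b then (∑ i, h i i) / q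
      else (∑ i, ∑ j, if i = j then 0 else h i j) / (q * ((q : K) ^ 2 - 1)) := by
  rw [← mean_perm_fst hq h a b]
  congr 1
  exact Fintype.sum_equiv (Equiv.mulLeft (Equiv.prodComm _ _)) _ _ fun f => rfl

theorem sum_offDiag_one {K : Type*} [Field K] {q : ℕ} :
    (∑ i : Fin q, ∑ j : Fin q, if i = j then (0 : K) else 1) =
    q * ((q : K) - 1) := by
  have : ∀ i : Fin q, (∑ j : Fin q, if i = j then (0 : K) else 1) = (q : K) - 1 := by
    intro i
    have : ∀ j : Fin q, (if i = j then (0 : K) else 1) = 1 - if i = j then 1 else 0 := by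
      intro j; split_ifs <;> simp
    simp [this]
  simp only [this, Finset.sum_const, Finset.card_univ, Fintype.card_fin, nsmul_eq_mul]

/-- A configuration of one copy of the system, after the permutation `f` acts on the wires
`l` and `r`. -/
def gateAct {W : Type*} [DecidableEq W] (l r : W) (f : GatePerm q) (s : W → Fin q) : W → Fin q :=
  Function.update (Function.update s l (f (s l, s r)).1) r (f (s l, s r)).2

/-- The permutation `f` acts on the wires `l` and `r` of both copies. -/
def pairAct {W : Type*} [DecidableEq W] (l r : W) (f : GatePerm q) (s : W → Leg q) : W → Leg q :=
  fun w => (gateAct l r f (fun w => (s w).1) w, gateAct l r f (fun w => (s w).2) w)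

/-- The mean of the observable `Φ` after a uniformly random permutation acts on the wires
`l` and `r`. -/
def avgAct {W : Type*} [DecidableEq W] (l r : W) (Φ : (W → Leg q) → K) (s : W → Leg q) : K :=
  (∑ f : GatePerm q, Φ (pairAct l r f s)) / (Fintype.card (GatePerm q) : K)

open Classical in
/-- The indicator of the event that the two copies agree outside `S`. -/
noncomputable def agree (K : Type*) [Field K] {W : Type*} (S : Set W) (s : W → Leg q) : K :=
  if ∀ w, w ∉ S → (s w).1 = (s w).2 then 1 else 0

open Classical in
/-- The observable that is `O` on the wire `y` and requires agreement outside `S` and `y`. -/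
noncomputable def opAgree {W : Type*} (y : W) (S : Set W) (O : Fin q → Fin q → K)
    (s : W → Leg q) : K :=
  if ∀ w, w ∉ S → w ≠ y → (s w).1 = (s w).2 then O (s y).1 (s y).2 else 0

theorem agree_eq_opAgree {W : Type*} {y : W} {S : Set W} (hy : y ∈ S) (s : W → Leg q) :
    agree K S s = opAgree y S (fun _ _ => 1) s := by
  classical
  simp only [agree, opAgree]
  refine if_congr (forall_congr' fun w => imp_congr_right fun hw => ?_) rfl rfl
  exact ⟨fun h _ => h, fun h => h (by rintro rfl; exact hw hy)⟩

variable {W : Type*} [DecidableEq W] {l r : W}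

theorem avgAct_add (Φ Ψ : (W → Leg q) → K) :
    avgAct l r (Φ + Ψ) = avgAct l r Φ + avgAct l r Ψ := by
  funext s
  simp [avgAct, Finset.sum_add_distrib, add_div]

theorem avgAct_smul (c : K) (Φ : (W → Leg q) → K) :
    avgAct l r (c • Φ) = c • avgAct l r Φ := by
  funext s
  simp [avgAct, ← Finset.mul_sum, mul_div_assoc]

/-- `avgAct` as a linear operator on observables. -/
def avgOp (l r : W) : Module.End K ((W → Leg q) → K) where
  toFun := avgAct l r
  map_add' := avgAct_add
  map_smul' := avgAct_smul

theorem avgOp_apply (l r : W) (Φ : (W → Leg q) → K) : avgOp l r Φ = avgAct l r Φ := rfl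

theorem pairAct_left (hlr : l ≠ r) (f : GatePerm q) (s : W → Leg q) :
    pairAct l r f s l = ((f ((s l).1, (s r).1)).1, (f ((s l).2, (s r).2)).1) := by
  simp [pairAct, gateAct, Function.update_of_ne hlr]

theorem pairAct_right (f : GatePerm q) (s : W → Leg q) :
    pairAct l r f s r = ((f ((s l).1, (s r).1)).2, (f ((s l).2, (s r).2)).2) := by
  simp [pairAct, gateAct]

theorem pairAct_of_ne {w : W} (hl : w ≠ l) (hr : w ≠ r) (f : GatePerm q) (s : W → Leg q) :
    pairAct l r f s w = s w := by
  simp [pairAct, gateAct, Function.update_of_ne hl, Function.update_of_ne hr]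

variable [CharZero K]

theorem avgAct_eq_of_forall {Φ Ψ : (W → Leg q) → K} {s : W → Leg q}
    (h : ∀ f, Φ (pairAct l r f s) = Ψ s) : avgAct l r Φ s = Ψ s := by
  have hN : (Fintype.card (GatePerm q) : K) ≠ 0 := by
    exact_mod_cast Fintype.card_ne_zero
  simp only [avgAct, h, Finset.sum_const, Finset.card_univ, nsmul_eq_mul]
  field_simp

/-- A gate inside `S` touches unconstrained wires only. A gate outside `S` applies one injective map
to the wire pairs of both copies, which preserves equality and inequality. -/
theorem agree_pairAct_iff (hlr : l ≠ r) {S : Set W} (hS : l ∈ S ↔ r ∈ S) (f : GatePerm q)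
    (s : W → Leg q) :
    (∀ w, w ∉ S → (pairAct l r f s w).1 = (pairAct l r f s w).2) ↔
      ∀ w, w ∉ S → (s w).1 = (s w).2 := by
  by_cases hl : l ∈ S
  · have hr := hS.1 hl
    refine forall_congr' fun w => imp_congr_right fun hw => ?_
    rw [pairAct_of_ne (by rintro rfl; exact hw hl) (by rintro rfl; exact hw hr)]
  · have hr : r ∉ S := fun h => hl (hS.2 h)
    have key : ∀ Z : W → Leg q, (∀ w, w ∉ S → (Z w).1 = (Z w).2) ↔
        ((∀ w, w ∉ S → w ≠ l → w ≠ r → (Z w).1 = (Z w).2) ∧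
          (((Z l).1, (Z r).1) = ((Z l).2, (Z r).2))) := by
      intro Z
      constructor
      · intro h
        exact ⟨fun w hw _ _ => h w hw, by rw [h l hl, h r hr]⟩
      · rintro ⟨h1, h2⟩ w hw
        rw [Prod.mk.injEq] at h2
        by_cases h3 : w = l
        · subst h3; exact h2.1
        by_cases h4 : w = r
        · subst h4; exact h2.2
        exact h1 w hw h3 h4
    rw [key, key s]
    refine and_congr ?_ ?_
    · refine forall_congr' fun w => imp_congr_right fun hw => imp_congr_right fun h1 =>
        imp_congr_right fun h2 => ?_
      rw [pairAct_of_ne h1 h2]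
    · rw [pairAct_left hlr, pairAct_right]
      simp only [Prod.mk.eta]
      exact f.injective.eq_iff

/-- A gate does not change the indicator of agreement outside `S` unless it cuts `S`. -/
theorem avgAct_agree_of_iff (hlr : l ≠ r) {S : Set W} (hS : l ∈ S ↔ r ∈ S) :
    avgAct l r (agree K S) = agree (q := q) K S := by
  classical
  funext s
  refine avgAct_eq_of_forall fun f => ?_
  simp only [agree]
  exact if_congr (agree_pairAct_iff hlr hS f s) rfl rfl

theorem avgAct_opAgree_of_ne (hlr : l ≠ r) {y : W} (hl : l ≠ y) (hr : r ≠ y)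
    (O : Fin q → Fin q → K) : avgAct l r (opAgree y ∅ O) = opAgree y ∅ O := by
  classical
  funext s
  refine avgAct_eq_of_forall fun f => ?_
  have := agree_pairAct_iff hlr (S := {y}) (by simp [hl, hr]) f s
  simp only [Set.mem_singleton_iff] at this
  simp only [opAgree, Set.mem_empty_iff_false, not_false_eq_true, true_imp_iff]
  rw [pairAct_of_ne hl.symm hr.symm]
  exact if_congr this rfl rfl

/-- The mean of a one-wire observable on a wire touched by the gate. -/
theorem avgAct_opAgree (hq : 2 ≤ q) (hlr : l ≠ r) {y : W} {S : Set W}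
    (hy : y = l ∧ r ∉ S ∨ y = r ∧ l ∉ S) (O : Fin q → Fin q → K) (s : W → Leg q) :
    avgAct l r (opAgree y S O) s = (∑ i, O i i) / q * agree K (S \ {l, r}) s +
      (∑ i, ∑ j, if i = j then 0 else O i j) / (q * ((q : K) ^ 2 - 1)) *
        (agree K (S ∪ {l, r}) s - agree K (S \ {l, r}) s) := by
  classical
  -- The gate does not reach these wires, so a disagreement there annihilates both sides.
  by_cases hrest : ∀ w, w ∉ S → w ≠ l → w ≠ r → (s w).1 = (s w).2
  · have e0 : agree K (S ∪ {l, r}) s = 1 := by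
      simp only [agree]
      rw [if_pos]
      intro w hw
      simp only [Set.mem_union, Set.mem_insert_iff, Set.mem_singleton_iff, not_or] at hw
      exact hrest w hw.1 hw.2.1 hw.2.2
    have e1 : agree K (S \ {l, r}) s =
        if ((s l).1, (s r).1) = ((s l).2, (s r).2) then 1 else 0 := by
      simp only [agree]
      refine if_congr ?_ rfl rfl
      simp only [Set.mem_sdiff, Set.mem_insert_iff, Set.mem_singleton_iff, Prod.mk.injEq]
      refine ⟨fun h => ⟨h l (by simp), h r (by simp)⟩, fun h w hw => ?_⟩
      by_cases h3 : w = l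
      · subst h3; exact h.1
      by_cases h4 : w = r
      · subst h4; exact h.2
      exact hrest w (fun hS => hw ⟨hS, by simp [h3, h4]⟩) h3 h4
    rw [e0, e1]
    have e2 : avgAct l r (opAgree y S O) s =
        if ((s l).1, (s r).1) = ((s l).2, (s r).2) then (∑ i, O i i) / q
        else (∑ i, ∑ j, if i = j then 0 else O i j) / (q * ((q : K) ^ 2 - 1)) := by
      rcases hy with ⟨rfl, hS⟩ | ⟨rfl, hS⟩
      · rw [← mean_perm_fst hq O]
        simp only [avgAct]
        congr 1
        refine Finset.sum_congr rfl fun f _ => ?_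
        simp only [opAgree]
        rw [pairAct_left hlr]
        refine if_congr ?_ rfl rfl
        constructor
        · intro h
          have := h r hS hlr.symm
          rwa [pairAct_right] at this
        · intro h w hwS hw
          by_cases h4 : w = r
          · subst h4; rwa [pairAct_right]
          · rw [pairAct_of_ne hw h4]; exact hrest w hwS hw h4
      · rw [← mean_perm_snd hq O]
        simp only [avgAct]
        congr 1
        refine Finset.sum_congr rfl fun f _ => ?_
        simp only [opAgree]
        rw [pairAct_right]
        refine if_congr ?_ rfl rfl
        constructor
        · intro h
          have := h l hS hlr
          rwa [pairAct_left hlr] at this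
        · intro h w hwS hw
          by_cases h4 : w = l
          · subst h4; rwa [pairAct_left hlr]
          · rw [pairAct_of_ne h4 hw]; exact hrest w hwS h4 hw
    rw [e2]
    split_ifs <;> simp
  · have e0 : agree K (S ∪ {l, r}) s = 0 := by
      simp only [agree]
      rw [if_neg]
      intro h
      refine hrest fun w hS h1 h2 => h w ?_
      simp [hS, h1, h2]
    have e1 : agree K (S \ {l, r}) s = 0 := by
      simp only [agree]
      rw [if_neg]
      exact fun h => hrest fun w hS _ _ => h w (fun h => hS h.1)
    rw [e0, e1]
    simp only [avgAct]
    rw [Finset.sum_eq_zero]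
    · simp
    · intro f _
      simp only [opAgree]
      rw [if_neg]
      intro h
      refine hrest fun w hS h1 h2 => ?_
      have := h w hS (by rcases hy with ⟨rfl, _⟩ | ⟨rfl, _⟩ <;> assumption)
      rwa [pairAct_of_ne h1 h2] at this

/-- A gate that cuts `S` either removes both of its wires from `S` or adds both of them. -/
theorem avgAct_agree_of_cut (hq : 2 ≤ q) (hlr : l ≠ r) {S : Set W} (hS : ¬(l ∈ S ↔ r ∈ S))
    (s : W → Leg q) :
    avgAct l r (agree K S) s = q / (1 + q) * agree K (S \ {l, r}) s +
      1 / (1 + q) * agree K (S ∪ {l, r}) s := by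
  have hq0 : (q : K) ≠ 0 := by
    have : q ≠ 0 := by omega
    exact_mod_cast this
  have hq1 : (q : K) ^ 2 - 1 ≠ 0 := by
    have : q ^ 2 ≠ 1 := by nlinarith
    rw [sub_ne_zero]
    exact_mod_cast this
  have hq2 : (1 : K) + q ≠ 0 := by
    have : 1 + q ≠ 0 := by omega
    exact_mod_cast this
  -- The one wire in `S` carries the constant observable `1`. Its diagonal mean is `1`, and its
  -- off-diagonal mean is `q(q-1) / (q(q²-1)) = 1/(1+q)`.
  obtain ⟨y, hyS, hy⟩ : ∃ y, y ∈ S ∧ (y = l ∧ r ∉ S ∨ y = r ∧ l ∉ S) := by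
    by_cases hl : l ∈ S
    · exact ⟨l, hl, Or.inl ⟨rfl, fun h => hS (by simp [hl, h])⟩⟩
    · exact ⟨r, by_contra fun h => hS (by simp [hl, h]), Or.inr ⟨rfl, hl⟩⟩
  rw [funext (agree_eq_opAgree (K := K) (q := q) hyS), avgAct_opAgree hq hlr hy,
    sum_offDiag_one]
  have hne : (q : K) - 1 ≠ 0 := fun h => hq1 (by linear_combination (q + 1 : K) * h)
  have e : (q : K) * (q - 1) / (q * (q ^ 2 - 1)) = 1 / (1 + q) := by
    rw [div_eq_div_iff (mul_ne_zero hq0 hq1) hq2]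
    ring
  rw [e]
  have e3 : (q : K) / (1 + q) = 1 - 1 / (1 + q) := by field_simp; ring
  rw [e3]
  simp only [Finset.sum_const, Finset.card_univ, Fintype.card_fin, nsmul_eq_mul, mul_one]
  rw [div_self hq0]
  ring

theorem avgOp_agree_of_iff (hlr : l ≠ r) {S : Set W} (hS : l ∈ S ↔ r ∈ S) :
    avgOp l r (agree K S) = agree (q := q) K S :=
  avgAct_agree_of_iff hlr hS

theorem avgOp_agree_of_cut (hq : 2 ≤ q) (hlr : l ≠ r) {S : Set W} (hS : ¬(l ∈ S ↔ r ∈ S)) :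
    avgOp l r (agree (q := q) K S) = (q / (1 + q) : K) • agree K (S \ {l, r}) +
      (1 / (1 + q) : K) • agree K (S ∪ {l, r}) :=
  funext fun s => avgAct_agree_of_cut hq hlr hS s

theorem avgOp_opAgree_of_ne (hlr : l ≠ r) {y : W} (hl : l ≠ y) (hr : r ≠ y)
    (O : Fin q → Fin q → K) : avgOp l r (opAgree y ∅ O) = opAgree y ∅ O :=
  avgAct_opAgree_of_ne hlr hl hr O

/-- Under a gate that touches the wire `y`, a traceless observable on `y` behaves like a multiple
of the indicator that `y` is the only wire on which the copies differ. -/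
theorem avgOp_opAgree_of_trace_eq_zero (hq : 2 ≤ q) (hlr : l ≠ r) {y : W} (hy : y = l ∨ y = r)
    (O : Fin q → Fin q → K) (hO : ∑ i, O i i = 0) :
    avgOp l r (opAgree y ∅ O) = ((∑ i, ∑ j, O i j) / (q * (q - 1))) •
      avgOp l r (agree K {y} - agree K ∅) := by
  have hq0 : (q : K) ≠ 0 := by
    have : q ≠ 0 := by omega
    exact_mod_cast this
  have hq2 : (1 : K) + q ≠ 0 := by
    have : 1 + q ≠ 0 := by omega
    exact_mod_cast this
  have hq3 : (q : K) - 1 ≠ 0 := by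
    rw [sub_ne_zero]
    have : q ≠ 1 := by omega
    exact_mod_cast this
  have hoff : (∑ i, ∑ j, if i = j then 0 else O i j) = ∑ i, ∑ j, O i j := by
    have : ∀ i j, (if i = j then 0 else O i j) = O i j - if i = j then O i j else 0 := by
      intro i j; split_ifs <;> simp
    simp [this, hO]
  have hcut : ¬(l ∈ ({y} : Set W) ↔ r ∈ ({y} : Set W)) := by
    rcases hy with rfl | rfl
    · simp [hlr.symm]
    · simp [hlr]
  have h1 : ({y} : Set W) \ {l, r} = ∅ := by
    rcases hy with rfl | rfl <;> simp [Set.sdiff_eq_empty]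
  have h2 : ({y} : Set W) ∪ {l, r} = {l, r} :=
    Set.union_eq_right.2 (by rcases hy with rfl | rfl <;> simp)
  -- Both sides become multiples of `agree K {l, r} - agree K ∅`. The constant observable on `y` has
  -- off-diagonal sum `q(q-1)`, which explains the denominator.
  rw [map_sub, avgOp_agree_of_cut hq hlr hcut, avgOp_agree_of_iff hlr (by simp), h1, h2]
  funext s
  rw [avgOp_apply, avgAct_opAgree hq hlr (by simpa using hy), hO, hoff]
  have h3 : (∅ : Set W) \ {l, r} = ∅ := by simp
  rw [h3]
  simp only [Set.empty_union, Pi.smul_apply, Pi.sub_apply, Pi.add_apply,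
    smul_eq_mul]
  have e : (∑ i, ∑ j, O i j) / (q * ((q : K) ^ 2 - 1)) =
      (∑ i, ∑ j, O i j) / (q * (q - 1)) * (1 / (1 + q)) := by
    rw [show (q : K) ^ 2 - 1 = (q - 1) * (1 + q) by ring]
    field_simp
  have e3 : (q : K) / (1 + q) = 1 - 1 / (1 + q) := by field_simp; ring
  rw [e, e3]
  ring

end GateAverage

/-! ### Evolution of arcs on a ring -/

section Ring

variable {q N : ℕ}

/-- The sites between the gaps `u` and `v` of a ring of `N` sites; gap `u` is to the left of
site `u`. -/
def arc (N : ℕ) (u v : ℤ) : Set (ZMod N) := {w | ∃ m : ℤ, u ≤ m ∧ m < v ∧ (m : ZMod N) = w}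

theorem arc_self (u : ℤ) : arc N u u = ∅ := by
  ext w
  simp only [arc, Set.mem_ofPred_eq, Set.mem_empty_iff_false, iff_false]
  rintro ⟨m, h1, h2, _⟩
  omega

theorem intCast_mem_arc {u v m : ℤ} (h1 : u ≤ m) (h2 : m < v) : (m : ZMod N) ∈ arc N u v :=
  ⟨m, h1, h2, rfl⟩

/-- The consecutive representatives `m` and `m + N` of the site lie on either side of the window
from `u` to `v`. -/
theorem intCast_notMem_arc {u v m : ℤ} (h1 : m < u) (h2 : v ≤ m + N) :
    (m : ZMod N) ∉ arc N u v := by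
  rintro ⟨k, h3, h4, h5⟩
  obtain ⟨c, hc⟩ := (ZMod.intCast_eq_intCast_iff_dvd_sub _ _ _).1 h5.symm
  have hN : 0 < (N : ℤ) := by omega
  have : 0 < c := by nlinarith
  nlinarith

theorem arc_anti {u v v' u' : ℤ} (hu : u' ≤ u) (hv : v ≤ v') : arc N u v ⊆ arc N u' v' := by
  rintro w ⟨m, h1, h2, rfl⟩
  exact intCast_mem_arc (by omega) (by omega)

theorem mem_arc_iff_of_not_cut {u v : ℤ} {n : ZMod N} (hu : (u : ZMod N) ≠ n + 1)
    (hv : (v : ZMod N) ≠ n + 1) : n ∈ arc N u v ↔ n + 1 ∈ arc N u v := by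
  constructor
  · rintro ⟨m, h1, h2, rfl⟩
    refine ⟨m + 1, by omega, ?_, by push_cast; rfl⟩
    by_contra h
    obtain rfl : v = m + 1 := by omega
    exact hv (by push_cast; rfl)
  · rintro ⟨m, h1, h2, h3⟩
    refine ⟨m - 1, ?_, by omega, by push_cast; rw [h3]; ring⟩
    by_contra h
    obtain rfl : u = m := by omega
    exact hu h3

/-- The bound on the length leaves a site outside the arc, so that site `u - 1` is not at the same
time the last site of the arc. -/
theorem arc_cut_left {u v : ℤ} {n : ZMod N} (hu : (u : ZMod N) = n + 1) (huv : u < v)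
    (hN : v - u + 1 ≤ N) :
    ¬(n ∈ arc N u v ↔ n + 1 ∈ arc N u v) ∧ arc N u v \ {n, n + 1} = arc N (u + 1) v ∧
      arc N u v ∪ {n, n + 1} = arc N (u - 1) v := by
  obtain rfl : n = ((u - 1 : ℤ) : ZMod N) := by push_cast; rw [hu]; ring
  rw [← hu]
  refine ⟨?_, ?_, ?_⟩
  · have h1 := intCast_mem_arc (N := N) (le_refl u) huv
    have h2 := intCast_notMem_arc (N := N) (u := u) (v := v) (m := u - 1) (by omega) (by omega)
    tauto
  · ext w
    constructor
    · rintro ⟨⟨m, h1, h2, rfl⟩, h3⟩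
      refine intCast_mem_arc ?_ h2
      by_contra h
      obtain rfl : m = u := by omega
      simp at h3
    · rintro ⟨m, h1, h2, rfl⟩
      refine ⟨intCast_mem_arc (by omega) h2, ?_⟩
      rintro (h | h)
      · exact intCast_notMem_arc (N := N) (u := u + 1) (v := v) (m := u - 1) (by omega) (by omega)
          (h ▸ intCast_mem_arc h1 h2)
      · exact intCast_notMem_arc (N := N) (u := u + 1) (v := v) (m := u) (by omega) (by omega)
          ((Set.mem_singleton_iff.1 h) ▸ intCast_mem_arc h1 h2)
  · ext w
    constructor
    · rintro (h | h | h)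
      · exact arc_anti (by omega) le_rfl h
      · exact h ▸ intCast_mem_arc (by omega) (by omega)
      · exact (Set.mem_singleton_iff.1 h) ▸ intCast_mem_arc (by omega) (by omega)
    · rintro ⟨m, h1, h2, rfl⟩
      rcases h1.lt_or_eq with h | rfl
      · exact Or.inl (intCast_mem_arc (by omega) h2)
      · exact Or.inr (Or.inl rfl)

theorem arc_cut_right {u v : ℤ} {n : ZMod N} (hv : (v : ZMod N) = n + 1) (huv : u < v)
    (hN : v - u + 1 ≤ N) :
    ¬(n ∈ arc N u v ↔ n + 1 ∈ arc N u v) ∧ arc N u v \ {n, n + 1} = arc N u (v - 1) ∧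
      arc N u v ∪ {n, n + 1} = arc N u (v + 1) := by
  obtain rfl : n = ((v - 1 : ℤ) : ZMod N) := by push_cast; rw [hv]; ring
  rw [← hv]
  have hvN : (v : ZMod N) = ((v - N : ℤ) : ZMod N) := by simp
  have hvN' : ((v - 1 : ℤ) : ZMod N) = ((v - 1 - N : ℤ) : ZMod N) := by simp
  refine ⟨?_, ?_, ?_⟩
  · have h1 := intCast_mem_arc (N := N) (u := u) (m := v - 1) (v := v) (by omega) (by omega)
    have h2 := intCast_notMem_arc (N := N) (u := u) (v := v) (m := v - N) (by omega) (by omega)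
    rw [← hvN] at h2
    tauto
  · ext w
    constructor
    · rintro ⟨⟨m, h1, h2, rfl⟩, h3⟩
      refine intCast_mem_arc h1 ?_
      by_contra h
      obtain rfl : m = v - 1 := by omega
      simp at h3
    · rintro ⟨m, h1, h2, rfl⟩
      refine ⟨intCast_mem_arc h1 (by omega), ?_⟩
      rintro (h | h)
      · rw [hvN'] at h
        exact intCast_notMem_arc (N := N) (u := u) (v := v - 1) (m := v - 1 - N) (by omega)
          (by omega) (h ▸ intCast_mem_arc h1 h2)
      · rw [hvN] at h
        exact intCast_notMem_arc (N := N) (u := u) (v := v - 1) (m := v - N) (by omega)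
          (by omega) ((Set.mem_singleton_iff.1 h) ▸ intCast_mem_arc h1 h2)
  · ext w
    constructor
    · rintro (h | h | h)
      · exact arc_anti le_rfl (by omega) h
      · exact h ▸ intCast_mem_arc (by omega) (by omega)
      · exact (Set.mem_singleton_iff.1 h) ▸ intCast_mem_arc (by omega) (by omega)
    · rintro ⟨m, h1, h2, rfl⟩
      rcases (show m ≤ v by omega).lt_or_eq with h | rfl
      · exact Or.inl (intCast_mem_arc h1 h)
      · exact Or.inr (Or.inr rfl)

/-- The averaged evolution of observables by gates on the sites `n, n + 1`; the gates are listed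
from the latest to the earliest. -/
def ringRun (K : Type*) [Field K] (q N : ℕ) : List (ZMod N) → Module.End K ((ZMod N → Leg q) → K)
  | [] => 1
  | n :: gs => ringRun K q N gs * avgOp n (n + 1)

/-- The evolution of a boundary of an arc, which starts at gap `u` and moves backwards in time:
a gate on the sites `n, n + 1` cuts the gap `n + 1` and moves it to the left or to the right. -/
def walk {X : Type*} (step : X → X → X) (init : ℤ → X) : List (ZMod N) → ℤ → X
  | [], u => init u
  | n :: gs, u =>
    if (u : ZMod N) = n + 1 then step (walk step init gs (u - 1)) (walk step init gs (u + 1))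
    else walk step init gs u

section Walk

variable {X : Type*} {step : X → X → X} {init : ℤ → X} {n : ZMod N} {gs : List (ZMod N)} {u : ℤ}

theorem walk_cut (h : (u : ZMod N) = n + 1) : walk step init (n :: gs) u =
    step (walk step init gs (u - 1)) (walk step init gs (u + 1)) := by
  rw [walk, if_pos h]

theorem walk_not_cut (h : (u : ZMod N) ≠ n + 1) :
    walk step init (n :: gs) u = walk step init gs u := by
  rw [walk, if_neg h]

end Walk

/-- The leftmost gap reached, backwards in time, from the gap `u`. -/
def reachLo : List (ZMod N) → ℤ → ℤ := walk min id

/-- The rightmost gap reached, backwards in time, from the gap `u`. -/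
def reachHi : List (ZMod N) → ℤ → ℤ := walk max id

/-- The probability that the left boundary of an arc, started at gap `u` and moving backwards in
time, ends to the left of site `0`. -/
noncomputable def leftProb (q : ℕ) : List (ZMod N) → ℤ → ℝ :=
  walk (fun a b => q / (1 + q) * b + 1 / (1 + q) * a) fun u => if u ≤ 0 then 1 else 0

/-- The probability that the right boundary of an arc, started at gap `u` and moving backwards in
time, ends to the right of site `0`. -/
noncomputable def rightProb (q : ℕ) : List (ZMod N) → ℤ → ℝ :=
  walk (fun a b => q / (1 + q) * a + 1 / (1 + q) * b) fun u => if 0 < u then 1 else 0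

theorem leftProb_cut {n : ZMod N} {gs : List (ZMod N)} {u : ℤ} (h : (u : ZMod N) = n + 1) :
    leftProb q (n :: gs) u =
      q / (1 + q) * leftProb q gs (u + 1) + 1 / (1 + q) * leftProb q gs (u - 1) :=
  walk_cut h

theorem leftProb_not_cut {n : ZMod N} {gs : List (ZMod N)} {u : ℤ} (h : (u : ZMod N) ≠ n + 1) :
    leftProb q (n :: gs) u = leftProb q gs u :=
  walk_not_cut h

theorem rightProb_cut {n : ZMod N} {gs : List (ZMod N)} {u : ℤ} (h : (u : ZMod N) = n + 1) :
    rightProb q (n :: gs) u =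
      q / (1 + q) * rightProb q gs (u - 1) + 1 / (1 + q) * rightProb q gs (u + 1) :=
  walk_cut h

theorem rightProb_not_cut {n : ZMod N} {gs : List (ZMod N)} {u : ℤ} (h : (u : ZMod N) ≠ n + 1) :
    rightProb q (n :: gs) u = rightProb q gs u :=
  walk_not_cut h

theorem reachLo_le (gs : List (ZMod N)) (u : ℤ) : reachLo gs u ≤ u := by
  induction gs generalizing u with
  | nil => exact le_rfl
  | cons n gs ih =>
    by_cases h : (u : ZMod N) = n + 1
    · refine (walk_cut h).trans_le ?_
      exact (min_le_left _ _).trans ((ih _).trans (by omega))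
    · exact (walk_not_cut h).trans_le (ih u)

theorem le_reachHi (gs : List (ZMod N)) (u : ℤ) : u ≤ reachHi gs u := by
  induction gs generalizing u with
  | nil => exact le_rfl
  | cons n gs ih =>
    by_cases h : (u : ZMod N) = n + 1
    · refine le_of_le_of_eq ?_ (walk_cut h).symm
      exact le_trans (by omega : u ≤ u + 1) ((ih _).trans (le_max_right _ _))
    · exact (ih u).trans_eq (walk_not_cut h).symm

theorem ringRun_agree_empty (hN : 1 < N) (gs : List (ZMod N)) (s : ZMod N → Leg q) :
    ringRun ℝ q N gs (agree ℝ ∅) s = agree ℝ ∅ s := by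
  have : Fact (1 < N) := ⟨hN⟩
  induction gs with
  | nil => rfl
  | cons n gs ih => rw [ringRun, Module.End.mul_apply, avgOp_agree_of_iff (by simp) (by simp), ih]

/-- If the copies differ at the site `0` only, the probability that the evolution makes them agree
outside an arc is a determinant. -/
theorem ringRun_agree_arc (hq : 2 ≤ q) (hN : 1 < N) {s : ZMod N → Leg q}
    (hs : ∀ w, (s w).1 = (s w).2 ↔ w ≠ 0) (gs : List (ZMod N)) {u v : ℤ} (huv : u ≤ v)
    (hw : reachHi gs v - reachLo gs u ≤ N) (hl : -(N : ℤ) < reachLo gs u)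
    (hr : reachHi gs v ≤ N) :
    ringRun ℝ q N gs (agree ℝ (arc N u v)) s =
      leftProb q gs u * rightProb q gs v -
        (q : ℝ) ^ (v - u) * (rightProb q gs u * leftProb q gs v) := by
  have : Fact (1 < N) := ⟨hN⟩
  have hq0 : (q : ℝ) ≠ 0 := by
    have : q ≠ 0 := by omega
    exact_mod_cast this
  have hq2 : (1 : ℝ) + q ≠ 0 := by positivity
  -- Ends that have met: the indicator of full agreement is zero because of site `0`, and the
  -- determinant cancels.
  rcases huv.eq_or_lt with rfl | huv
  · rw [arc_self, ringRun_agree_empty hN]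
    simp only [agree]
    rw [if_neg]
    · simp; ring
    · push Not
      exact ⟨0, by simp, fun h => (hs 0).1 h rfl⟩
  induction gs generalizing u v with
  | nil =>
    simp only [reachHi, reachLo, walk, id] at hw hl hr
    simp only [ringRun, Module.End.one_apply, leftProb, rightProb, walk, agree]
    -- The bounds `hl` and `hr` exclude that the arc contains site `0` through a representative
    -- other than the integer `0`. For `u < v` the second product of the determinant is then zero.
    have : (∀ w, w ∉ arc N u v → (s w).1 = (s w).2) ↔ u ≤ 0 ∧ 0 < v := by
      constructor
      · intro h
        by_contra hc
        have h0 : (0 : ZMod N) ∉ arc N u v := by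
          by_cases hu : u ≤ 0
          · have := intCast_notMem_arc (N := N) (u := u) (v := v) (m := -N) (by omega) (by omega)
            simpa using this
          · have := intCast_notMem_arc (N := N) (u := u) (v := v) (m := 0) (by omega) (by omega)
            simpa using this
        exact (hs 0).1 (h 0 h0) rfl
      · rintro ⟨h1, h2⟩ w hw
        rw [hs]
        rintro rfl
        exact hw (by simpa using intCast_mem_arc (N := N) h1 h2)
    simp only [this]
    rcases le_or_gt u 0 with h1 | h1 <;> rcases le_or_gt v 0 with h2 | h2
    · simp [h1, h2, h1.not_gt, h2.not_gt]
    · simp [h1, h2, h1.not_gt, h2.not_ge]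
    · omega
    · simp [h1, h2, h1.not_ge, h2.not_ge]
  | cons n gs ih =>
    have IH : ∀ {u v : ℤ}, u ≤ v → reachHi gs v - reachLo gs u ≤ N → -(N : ℤ) < reachLo gs u →
        reachHi gs v ≤ N → ringRun ℝ q N gs (agree ℝ (arc N u v)) s =
          leftProb q gs u * rightProb q gs v -
            (q : ℝ) ^ (v - u) * (rightProb q gs u * leftProb q gs v) := by
      intro u v huv hw hl hr
      rcases huv.eq_or_lt with rfl | huv
      · rw [arc_self, ringRun_agree_empty hN]
        simp only [agree]
        rw [if_neg]
        · simp; ring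
        · push Not
          exact ⟨0, by simp, fun h => (hs 0).1 h rfl⟩
      · exact ih huv.le hw hl hr huv
    rw [ringRun, Module.End.mul_apply]
    have hlo := reachLo_le (n :: gs) u
    have hhi := le_reachHi (n :: gs) v
    by_cases hu : (u : ZMod N) = n + 1
    · have hlo' : reachLo (n :: gs) u = min (reachLo gs (u - 1)) (reachLo gs (u + 1)) := walk_cut hu
      have h1 := reachLo_le gs (u - 1)
      have hb1 : reachLo (n :: gs) u ≤ reachLo gs (u - 1) := hlo' ▸ min_le_left _ _
      have hb2 : reachLo (n :: gs) u ≤ reachLo gs (u + 1) := hlo' ▸ min_le_right _ _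
      -- One gate cannot cut both ends, because `0 < v - u < N`: the left end can still move
      -- outwards within the permitted width.
      have hv : (v : ZMod N) ≠ n + 1 := by
        rw [← hu]
        intro h
        exact intCast_notMem_arc (N := N) (u := u + 1) (v := v + 1) (m := u) (by omega) (by omega)
          (h ▸ intCast_mem_arc (by omega) (by omega))
      have hhi' : reachHi (n :: gs) v = reachHi gs v := walk_not_cut hv
      obtain ⟨a1, a2, a3⟩ := arc_cut_left hu huv (by omega)
      -- The factor `q^(-u)` exchanges the weights of the two directions, so that `rightProb`
      -- follows the steps of a left end.
      rw [avgOp_agree_of_cut hq (by simp) a1, a2, a3, map_add, map_smul, map_smul, Pi.add_apply,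
        Pi.smul_apply, Pi.smul_apply, smul_eq_mul, smul_eq_mul,
        IH (by omega) (by omega) (by omega) (by omega),
        IH (by omega) (by omega) (by omega) (by omega),
        leftProb_cut hu, rightProb_not_cut hv, leftProb_not_cut hv, rightProb_cut hu,
        show v - u = (v - (u + 1)) + 1 by ring, show v - (u - 1) = (v - (u + 1)) + 2 by ring,
        zpow_add₀ hq0, zpow_add₀ hq0]
      simp only [zpow_ofNat]
      field_simp
      ring
    · have hlo' : reachLo (n :: gs) u = reachLo gs u := walk_not_cut hu
      by_cases hv : (v : ZMod N) = n + 1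
      · have hhi' : reachHi (n :: gs) v = max (reachHi gs (v - 1)) (reachHi gs (v + 1)) := walk_cut hv
        have h1 := le_reachHi gs (v + 1)
        have hb1 : reachHi gs (v - 1) ≤ reachHi (n :: gs) v := hhi' ▸ le_max_left _ _
        have hb2 : reachHi gs (v + 1) ≤ reachHi (n :: gs) v := hhi' ▸ le_max_right _ _
        obtain ⟨a1, a2, a3⟩ := arc_cut_right hv huv (by omega)
        rw [avgOp_agree_of_cut hq (by simp) a1, a2, a3, map_add, map_smul, map_smul, Pi.add_apply,
          Pi.smul_apply, Pi.smul_apply, smul_eq_mul, smul_eq_mul,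
          IH (by omega) (by omega) (by omega) (by omega),
          IH (by omega) (by omega) (by omega) (by omega),
          leftProb_not_cut hu, rightProb_cut hv, leftProb_cut hv, rightProb_not_cut hu,
          show v - u = (v - 1 - u) + 1 by ring, show v + 1 - u = (v - 1 - u) + 2 by ring,
          zpow_add₀ hq0, zpow_add₀ hq0]
        simp only [zpow_ofNat]
        field_simp
        ring
      · rw [avgOp_agree_of_iff (by simp) (mem_arc_iff_of_not_cut hu hv), leftProb_not_cut hu,
          rightProb_not_cut hv, rightProb_not_cut hu, leftProb_not_cut hv]
        have hhi' : reachHi (n :: gs) v = reachHi gs v := walk_not_cut hv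
        exact IH huv.le (by omega) (by omega) (by omega)

end Ring

/-! ### The functions `A` as rescaled binomial tail probabilities -/

section Tail

theorem binom_natCast (n k : ℕ) : binom n k = n.choose k := by
  simp [binom, Ring.choose_natCast]

theorem binom_neg_one {n : ℤ} (hn : -1 ≤ n) : binom n (-1) = if n = -1 then 1 else 0 := by
  rw [binom, if_neg (by norm_num), if_pos hn]
  split_ifs with h
  · subst h
    simp
  · obtain ⟨m, rfl⟩ := Int.eq_ofNat_of_zero_le (show 0 ≤ n by omega)
    have : ((m : ℤ) - -1).toNat = m + 1 := by omega
    rw [this, Ring.choose_natCast]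
    simp

theorem binom_pascal {i m : ℤ} (hi : 1 ≤ i) (hm : 1 ≤ m) :
    binom (i - 1 + m) (i - 1) = binom (i - 1 - 1 + m) (i - 1 - 1) + binom (i - 1 + (m - 1)) (i - 1) := by
  obtain ⟨m, rfl⟩ : ∃ k : ℕ, m = k + 1 := ⟨(m - 1).toNat, by omega⟩
  obtain ⟨i, rfl⟩ : ∃ k : ℕ, i = k + 1 := ⟨(i - 1).toNat, by omega⟩
  -- In the first case one summand has lower entry `-1` and nonnegative upper entry, hence vanishes
  -- by convention.
  rcases i with _ | i
  · have h1 := binom_natCast (m + 1) 0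
    have h2 := binom_natCast m 0
    have h3 := binom_neg_one (n := m) (by omega)
    rw [if_neg (by omega)] at h3
    push_cast at h1 h2
    simp only [Nat.cast_zero, zero_add, sub_self, zero_sub]
    rw [h1, show (-1 + ((m : ℤ) + 1)) = m by ring, h3]
    simp [h2]
  · have h1 := binom_natCast (i + 1 + (m + 1)) (i + 1)
    have h2 := binom_natCast (i + 1 + m) (i + 1)
    have h3 := binom_natCast (i + 1 + m) i
    push_cast at h1 h2 h3 ⊢
    rw [show (i : ℤ) + 1 + 1 - 1 + (m + 1) = i + 1 + (m + 1) by ring,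
      show (i : ℤ) + 1 + 1 - 1 = i + 1 by ring, h1,
      show (i : ℤ) + 1 - 1 + (m + 1) = i + 1 + m by ring, show (i : ℤ) + 1 - 1 = i by ring, h3,
      show (i : ℤ) + 1 + (m + 1 - 1) = i + 1 + m by ring, h2]
    rw [show i + 1 + (m + 1) = (i + 1 + m) + 1 by ring, Nat.choose_succ_succ]
    push_cast
    rfl

theorem binom_sub_one_self {i : ℤ} (hi : 0 ≤ i) : binom (i - 1) (i - 1) = 1 := by
  obtain ⟨i, rfl⟩ := Int.eq_ofNat_of_zero_le hi
  rcases i with _ | i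
  · exact binom_neg_one le_rfl
  · have := binom_natCast i i
    simpa using this

theorem A_of_nonpos {x y : ℤ} (hy : y ≤ 0) (h : x ≠ 0 ∨ y ≠ 0) (z : ℝ) : A x y z = 0 := by
  rw [A, Finset.Icc_eq_empty (by omega), if_neg (by omega)]
  simp

theorem A_zero_left {y : ℤ} (hy : 0 ≤ y) (z : ℝ) : A 0 y z = z ^ y := by
  rcases hy.eq_or_lt with rfl | hy
  · simp [A]
  · rw [A, if_neg (by omega), Finset.sum_eq_single y]
    · have := binom_sub_one_self (i := 0) le_rfl
      simp only [zero_sub] at this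
      simp [this]
    · intro s hs hsy
      rw [Finset.mem_Icc] at hs
      rw [zero_sub, binom_neg_one (by omega), if_neg (by omega)]
      simp
    · intro h
      exact absurd (Finset.mem_Icc.2 ⟨by omega, le_rfl⟩) h

theorem A_pascal {x y : ℤ} (hx : 1 ≤ x) (hy : 1 ≤ y) (z : ℝ) :
    A x y z = A (x - 1) y z + A x (y - 1) z := by
  rw [A, A, A, if_neg (by omega), if_neg (by omega), if_neg (by omega)]
  have : Finset.Icc 1 y = insert y (Finset.Icc 1 (y - 1)) := by
    ext s
    simp only [Finset.mem_Icc, Finset.mem_insert]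
    omega
  rw [this, Finset.sum_insert (by simp), Finset.sum_insert (by simp)]
  -- The term `s = y` has coefficient `1` in both `A x y` and `A (x - 1) y` and is absent from `A x
  -- (y - 1)`. For `x = 1` this uses the convention `binom (-1) (-1) = 1`.
  have e1 : binom (x - 1 + y - y) (x - 1) = 1 := by
    rw [add_sub_cancel_right, binom_sub_one_self (by omega)]
  have e2 : binom (x - 1 - 1 + y - y) (x - 1 - 1) = 1 := by
    rw [add_sub_cancel_right, binom_sub_one_self (by omega)]
  have e3 : ∀ s ∈ Finset.Icc 1 (y - 1), (binom (x - 1 + y - s) (x - 1) : ℝ) * z ^ s =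
      (binom (x - 1 - 1 + y - s) (x - 1 - 1) : ℝ) * z ^ s +
        (binom (x - 1 + (y - 1) - s) (x - 1) : ℝ) * z ^ s := by
    intro s hs
    rw [Finset.mem_Icc] at hs
    have := binom_pascal hx (m := y - s) (by omega)
    rw [show x - 1 + y - s = x - 1 + (y - s) by ring, this,
      show x - 1 - 1 + y - s = x - 1 - 1 + (y - s) by ring,
      show x - 1 + (y - 1) - s = x - 1 + (y - s - 1) by ring]
    push_cast
    ring
  rw [e1, e2, Finset.sum_congr rfl e3, Finset.sum_add_distrib]
  ring

/-- The probability of at least `i` successes in `i + j - 1` trials with success probability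
`1 / (1 + q)`. -/
noncomputable def tail (q : ℕ) (i j : ℤ) : ℝ :=
  if i ≤ 0 then 1 else if j ≤ 0 then 0 else
    (1 / (1 + q) : ℝ) ^ i * (q / (1 + q) : ℝ) ^ j * A i j (α q)

variable {q : ℕ}

/-- On the edge `i = 0` the formula gives `1` because `α q` is the inverse of `q/(1+q)`; on the edge
`j = 0` with `i > 0` the sum in `A` is empty. -/
theorem tail_eq (hq : 2 ≤ q) {i j : ℤ} (hi : 0 ≤ i) (hj : 0 ≤ j) :
    tail q i j = (1 / (1 + q) : ℝ) ^ i * (q / (1 + q) : ℝ) ^ j * A i j (α q) := by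
  have hq0 : (q : ℝ) ≠ 0 := by
    have : q ≠ 0 := by omega
    exact_mod_cast this
  have hq2 : (1 : ℝ) + q ≠ 0 := by positivity
  rw [tail]
  split_ifs with h1 h2
  · obtain rfl : i = 0 := by omega
    rw [A_zero_left hj, zpow_zero, one_mul, ← mul_zpow]
    have : (q / (1 + q) : ℝ) * α q = 1 := by
      rw [α]; field_simp
      ring
    rw [this, one_zpow]
  · rw [A_of_nonpos h2 (by omega), mul_zero]
  · rfl

/-- Condition on one trial. The bound on `i + j` excludes `i = 1`, `j ≤ 0`, where the boundary
values `0` and `1` would clash. -/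
theorem tail_rec (hq : 2 ≤ q) {i j : ℤ} (hij : 2 ≤ i + j) :
    tail q i j = q / (1 + q) * tail q i (j - 1) + 1 / (1 + q) * tail q (i - 1) j := by
  have hq0 : (q : ℝ) ≠ 0 := by
    have : q ≠ 0 := by omega
    exact_mod_cast this
  have hq2 : (1 : ℝ) + q ≠ 0 := by positivity
  by_cases hi : i ≤ 0
  · rw [tail, tail, tail, if_pos hi, if_pos hi, if_pos (by omega)]
    field_simp
    ring
  by_cases hj : j ≤ 0
  · rw [tail, tail, tail, if_neg hi, if_pos hj, if_neg hi, if_pos (by omega), if_neg (by omega),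
      if_pos hj]
    ring
  · rw [tail_eq hq (by omega) (by omega), tail_eq hq (by omega) (by omega),
      tail_eq hq (by omega) (by omega), A_pascal (by omega) (by omega)]
    have e1 : (1 / (1 + q) : ℝ) ^ i = (1 / (1 + q) : ℝ) ^ (i - 1) * (1 / (1 + q)) := by
      rw [← zpow_add_one₀ (by positivity)]; congr 1; ring
    have e2 : (q / (1 + q) : ℝ) ^ j = (q / (1 + q) : ℝ) ^ (j - 1) * (q / (1 + q)) := by
      rw [← zpow_add_one₀ (div_ne_zero hq0 hq2)]; congr 1; ring
    rw [e1, e2]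
    ring

/-- The value at the vertex `(i, j)` of the probability carried by a right boundary. -/
noncomputable def rightTail (q : ℕ) (i j : ℤ) : ℝ := if i ≤ 0 then 0 else tail q j i

theorem rightTail_rec (hq : 2 ≤ q) {i j : ℤ} (hij : 2 ≤ i + j) :
    rightTail q i j = q / (1 + q) * rightTail q (i - 1) j + 1 / (1 + q) * rightTail q i (j - 1) := by
  rw [rightTail, rightTail, rightTail]
  by_cases hi : i ≤ 0
  · rw [if_pos hi, if_pos (by omega), if_pos hi]
    ring
  · rw [if_neg hi, if_neg hi, tail_rec hq (by omega)]
    split_ifs with h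
    · rw [tail, if_neg (by omega), if_pos h]
    · rfl

/-- Failure is `q` times as likely as success, so the prefactor `q` gives both products the same
power weight. Pascal's rule then eliminates `A (x - 1) y` and `A y (x - 1)`, and the terms `A x y *
A y x` cancel. -/
theorem tail_det (hq : 2 ≤ q) {x y : ℤ} (hx : 1 ≤ x) (hy : 1 ≤ y) :
    tail q (x - 1) y * tail q y x - q * (tail q x y * tail q y (x - 1)) =
      (1 + q) * (q / (1 + q) ^ 2 : ℝ) ^ (x + y) *
        (A x y (α q) * A (y - 1) x (α q) - A x (y - 1) (α q) * A y x (α q)) := by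
  have hq0 : (q : ℝ) ≠ 0 := by
    have : q ≠ 0 := by omega
    exact_mod_cast this
  have hq2 : (1 : ℝ) + q ≠ 0 := by positivity
  rw [tail_eq hq (by omega) (by omega), tail_eq hq (by omega) (by omega),
    tail_eq hq (by omega) (by omega), tail_eq hq (by omega) (by omega)]
  have h1 := A_pascal hx hy (α q)
  have h2 := A_pascal hy hx (α q)
  have e1 : (1 / (1 + q) : ℝ) ^ x = (1 / (1 + q) : ℝ) ^ (x - 1) * (1 / (1 + q)) := by
    rw [← zpow_add_one₀ (by positivity)]; congr 1; ring
  have e2 : (q / (1 + q) : ℝ) ^ x = (q / (1 + q) : ℝ) ^ (x - 1) * (q / (1 + q)) := by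
    rw [← zpow_add_one₀ (div_ne_zero hq0 hq2)]; congr 1; ring
  have e3 : (q / (1 + q) ^ 2 : ℝ) ^ (x + y) = (1 / (1 + q) : ℝ) ^ (x - 1) * (1 / (1 + q)) *
      ((q / (1 + q) : ℝ) ^ (x - 1) * (q / (1 + q))) *
      ((1 / (1 + q) : ℝ) ^ y * (q / (1 + q) : ℝ) ^ y) := by
    rw [← e1, ← e2, ← mul_zpow, ← mul_zpow, ← zpow_add₀]
    · congr 1
      field_simp
    · exact mul_ne_zero (by positivity) (div_ne_zero hq0 hq2)
  have e4 : A (y - 1) x (α q) = A y x (α q) - A y (x - 1) (α q) := by rw [h2]; ring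
  have e5 : A x (y - 1) (α q) = A x y (α q) - A (x - 1) y (α q) := by rw [h1]; ring
  rw [e1, e2, e3, e4, e5]
  field_simp
  ring

/-- Extends `tail_det` to points outside the light cone, where both sides vanish. -/
theorem tail_rightTail_det (hq : 2 ≤ q) {x y : ℤ} (hxy : 2 ≤ x + y) :
    tail q y x * rightTail q y (x - 1) - q * (rightTail q y x * tail q y (x - 1)) =
      (1 + q) * (q / (1 + q) ^ 2 : ℝ) ^ (x + y) *
        (A x y (α q) * A (y - 1) x (α q) - A x (y - 1) (α q) * A y x (α q)) := by
  by_cases hy : y ≤ 0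
  · rw [rightTail, rightTail, if_pos hy, if_pos hy, A_of_nonpos hy (by omega),
      A_of_nonpos (x := x) (y := y - 1) (by omega) (by omega)]
    ring
  by_cases hx : x ≤ 0
  · rw [tail, if_neg hy, if_pos hx, tail, if_neg hy, if_pos (by omega),
      A_of_nonpos (x := y) hx (by omega), A_of_nonpos (x := y - 1) hx (by omega)]
    ring
  · rw [rightTail, rightTail, if_neg hy, if_neg hy, ← tail_det hq (by omega) (by omega)]
    ring

end Tail

/-! ### The brickwork layers -/

section Layers

variable {q L : ℕ}

/-- The left sites of the gates of a half-step. -/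
def layerSites (L h : ℕ) : List (ZMod (2 * L)) :=
  List.ofFn fun j : Fin L => ((2 * (j : ℕ) + h : ℕ) : ZMod (2 * L))

/-- The left sites of the gates in the first `n` half-steps, from the latest to the earliest. -/
def halfSites (L : ℕ) : ℕ → List (ZMod (2 * L))
  | 0 => []
  | n + 1 => layerSites L (n % 2) ++ halfSites L n

/-- The number of sites is even, so the parity of a gap is well defined on the ring, and each
half-step cuts gaps of one parity. -/
theorem emod_two_of_cut {h : ℕ} {n : ZMod (2 * L)} (hn : n ∈ layerSites L h) {u : ℤ}
    (hu : (u : ZMod (2 * L)) = n + 1) : u % 2 = (h + 1 : ℤ) % 2 := by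
  obtain ⟨j, rfl⟩ := List.mem_ofFn.1 hn
  have : (u : ZMod (2 * L)) = ((2 * (j : ℕ) + h + 1 : ℤ) : ZMod (2 * L)) := by
    rw [hu]; push_cast; ring
  rw [ZMod.intCast_eq_intCast_iff_dvd_sub] at this
  have h2 : (2 : ℤ) ∣ 2 * (j : ℕ) + h + 1 - u :=
    (Dvd.intro (L : ℤ) (by push_cast; rfl)).trans this
  omega

theorem exists_cut [NeZero L] {h : ℕ} {u : ℤ} (hu : u % 2 = (h + 1 : ℤ) % 2) :
    ∃ n ∈ layerSites L h, (u : ZMod (2 * L)) = n + 1 := by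
  have hL : (0 : ℤ) < L := by exact_mod_cast NeZero.pos L
  obtain ⟨m, hm⟩ : ∃ m : ℤ, u = 2 * m + h + 1 := ⟨(u - h - 1) / 2, by omega⟩
  have h1 := Int.emod_nonneg m hL.ne'
  have h2 := Int.emod_lt_of_pos m hL
  refine ⟨((2 * (m % L).toNat + h : ℕ) : ZMod (2 * L)), ?_, ?_⟩
  · exact List.mem_ofFn.2 ⟨⟨(m % L).toNat, by omega⟩, rfl⟩
  · have : (((m % L).toNat : ℕ) : ZMod (2 * L)) = ((m % L : ℤ) : ZMod (2 * L)) := by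
      rw [← Int.cast_natCast, Int.toNat_of_nonneg h1]
    push_cast
    rw [this, hm]
    have h3 : ((2 * m + h + 1 : ℤ) : ZMod (2 * L)) = ((2 * (m % L) + h + 1 : ℤ) : ZMod (2 * L)) := by
      rw [ZMod.intCast_eq_intCast_iff_dvd_sub]
      refine ⟨-(m / L), ?_⟩
      have := Int.emod_add_mul_ediv m L
      push_cast
      linear_combination 2 * this
    rw [h3]
    push_cast
    rfl

variable {X : Type*} {step : X → X → X} {init : ℤ → X}

theorem walk_append_of_forall_not_cut {N : ℕ} {js gs : List (ZMod N)} {u : ℤ}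
    (h : ∀ n ∈ js, (u : ZMod N) ≠ n + 1) :
    walk step init (js ++ gs) u = walk step init gs u := by
  induction js with
  | nil => rfl
  | cons n js ih =>
    rw [List.cons_append, walk_not_cut (h n (by simp)), ih fun m hm => h m (by simp [hm])]

/-- A layer moves a boundary only once: no gate of the layer cuts the neighbouring gaps at which it
arrives. -/
theorem walk_append_of_exists_cut {N : ℕ} {js gs : List (ZMod N)} {u : ℤ}
    (h : ∃ n ∈ js, (u : ZMod N) = n + 1) (h1 : ∀ n ∈ js, ((u - 1 : ℤ) : ZMod N) ≠ n + 1)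
    (h2 : ∀ n ∈ js, ((u + 1 : ℤ) : ZMod N) ≠ n + 1) :
    walk step init (js ++ gs) u =
      step (walk step init gs (u - 1)) (walk step init gs (u + 1)) := by
  induction js with
  | nil => simp at h
  | cons n js ih =>
    by_cases hn : (u : ZMod N) = n + 1
    · rw [List.cons_append, walk_cut hn,
        walk_append_of_forall_not_cut fun m hm => h1 m (by simp [hm]),
        walk_append_of_forall_not_cut fun m hm => h2 m (by simp [hm])]
    · rw [List.cons_append, walk_not_cut hn]
      refine ih ?_ (fun m hm => h1 m (by simp [hm])) (fun m hm => h2 m (by simp [hm]))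
      obtain ⟨m, hm, hum⟩ := h
      rcases List.mem_cons.1 hm with rfl | hm
      · exact absurd hum hn
      · exact ⟨m, hm, hum⟩

theorem walk_halfSites_succ_of_ne {n : ℕ} {u : ℤ} (hu : u % 2 ≠ (n + 1 : ℤ) % 2) :
    walk step init (halfSites L (n + 1)) u = walk step init (halfSites L n) u :=
  walk_append_of_forall_not_cut fun m hm hum => by
    have := emod_two_of_cut hm hum
    push_cast at this
    omega

theorem walk_halfSites_succ [NeZero L] {n : ℕ} {u : ℤ} (hu : u % 2 = (n + 1 : ℤ) % 2) :
    walk step init (halfSites L (n + 1)) u =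
      step (walk step init (halfSites L n) (u - 1)) (walk step init (halfSites L n) (u + 1)) := by
  refine walk_append_of_exists_cut (exists_cut (by push_cast; omega)) ?_ ?_ <;>
  · intro m hm hum
    have := emod_two_of_cut hm hum
    push_cast at this
    omega

theorem le_reachLo_halfSites [NeZero L] (n : ℕ) (u : ℤ) :
    u - n ≤ reachLo (halfSites L n) u := by
  induction n generalizing u with
  | zero => simp [halfSites, reachLo, walk]
  | succ n ih =>
    by_cases hu : u % 2 = (n + 1 : ℤ) % 2
    · refine le_of_le_of_eq ?_ (walk_halfSites_succ hu).symm
      have h1 := ih (u - 1)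
      have h2 := ih (u + 1)
      push_cast
      exact le_min (le_trans (by omega) h1) (le_trans (by omega) h2)
    · refine le_of_le_of_eq ?_ (walk_halfSites_succ_of_ne hu).symm
      push_cast
      exact le_trans (by omega) (ih u)

theorem reachHi_halfSites_le [NeZero L] (n : ℕ) (u : ℤ) :
    reachHi (halfSites L n) u ≤ u + n := by
  induction n generalizing u with
  | zero => simp [halfSites, reachHi, walk]
  | succ n ih =>
    by_cases hu : u % 2 = (n + 1 : ℤ) % 2
    · refine (walk_halfSites_succ hu).trans_le ?_
      have h1 := ih (u - 1)
      have h2 := ih (u + 1)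
      push_cast
      exact max_le (h1.trans (by omega)) (h2.trans (by omega))
    · refine (walk_halfSites_succ_of_ne hu).trans_le ?_
      push_cast
      exact (ih u).trans (by omega)

/-- The gaps `i - j + 1` with `i + j = n + 1` have the parity cut by the latest of the `n`
half-steps, so the walk moves at every half-step. After `k` steps to the left out of `n` it ends at
`2 * i - 2 * k`, which is nonpositive exactly when `k ≥ i`. -/
theorem leftProb_halfSites [NeZero L] (hq : 2 ≤ q) (n : ℕ) {i j : ℤ} (hij : i + j = n + 1) :
    leftProb q (halfSites L n) (i - j + 1) = tail q i j := by
  induction n generalizing i j with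
  | zero =>
    simp only [halfSites, leftProb, walk, tail]
    by_cases h : i ≤ 0
    · rw [if_pos h, if_pos (by omega)]
    · rw [if_neg h, if_neg (by omega), if_pos (by omega)]
  | succ n ih =>
    push_cast at hij
    refine (walk_halfSites_succ (by omega)).trans ?_
    have h1 := ih (i := i) (j := j - 1) (by omega)
    have h2 := ih (i := i - 1) (j := j) (by omega)
    rw [tail_rec hq (by omega), ← h1, ← h2, leftProb]
    simp only [show i - (j - 1) + 1 = i - j + 1 + 1 by ring,
      show i - 1 - j + 1 = i - j + 1 - 1 by ring]

theorem rightProb_halfSites [NeZero L] (hq : 2 ≤ q) (n : ℕ) {i j : ℤ} (hij : i + j = n + 1) :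
    rightProb q (halfSites L n) (i - j + 1) = rightTail q i j := by
  induction n generalizing i j with
  | zero =>
    simp only [halfSites, rightProb, walk, rightTail, tail]
    by_cases h : i ≤ 0
    · rw [if_pos h, if_neg (by omega)]
    · rw [if_neg h, if_pos (by omega), if_pos (by omega)]
  | succ n ih =>
    push_cast at hij
    refine (walk_halfSites_succ (by omega)).trans ?_
    have h1 := ih (i := i) (j := j - 1) (by omega)
    have h2 := ih (i := i - 1) (j := j) (by omega)
    rw [rightTail_rec hq (by omega), ← h1, ← h2, rightProb]
    simp only [show i - (j - 1) + 1 = i - j + 1 + 1 by ring,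
      show i - 1 - j + 1 = i - j + 1 - 1 by ring]

/-- The probability that a single difference at the site `0` evolves into a single difference at
the site `2 * x`. -/
theorem ringRun_agree_singleton [NeZero L] (hq : 2 ≤ q) {t : ℕ} (ht : 1 ≤ t) (htL : 2 * t ≤ L)
    {x : ℤ} (hx1 : -(L : ℤ) < 2 * x) (hx2 : 2 * x ≤ L) {s : ZMod (2 * L) → Leg q}
    (hs : ∀ w, (s w).1 = (s w).2 ↔ w ≠ 0) :
    ringRun ℝ q (2 * L) (halfSites L (2 * t)) (agree ℝ {((2 * x : ℤ) : ZMod (2 * L))}) s =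
      (1 + q) * (q / (1 + q) ^ 2 : ℝ) ^ (2 * t + 1) *
        (A (t - x + 1) (t + x) (α q) * A (t + x - 1) (t - x + 1) (α q) -
          A (t - x + 1) (t + x - 1) (α q) * A (t + x) (t - x + 1) (α q)) := by
  obtain ⟨n, hn⟩ : ∃ n, 2 * t = n + 1 := ⟨2 * t - 1, by omega⟩
  have harc : arc (2 * L) (2 * x) (2 * x + 1) = {((2 * x : ℤ) : ZMod (2 * L))} := by
    ext w
    constructor
    · rintro ⟨m, h1, h2, rfl⟩
      obtain rfl : m = 2 * x := by omega
      rfl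
    · rintro rfl
      exact intCast_mem_arc (by omega) (by omega)
  have hnt : (n : ℤ) + 1 = 2 * t := by exact_mod_cast hn.symm
  have hlo := le_reachLo_halfSites (L := L) (2 * t) (2 * x)
  -- The right end `2 * x + 1` has the wrong parity for the latest half-step and moves only `n = 2 *
  -- t - 1` times. The unit of width gained is needed when `L = 2 * t`.
  have hhi := reachHi_halfSites_le (L := L) n (2 * x + 1)
  have hne : (2 * x + 1) % 2 ≠ (n + 1 : ℤ) % 2 := by omega
  have hhi' : reachHi (halfSites L (2 * t)) (2 * x + 1) = reachHi (halfSites L n) (2 * x + 1) := by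
    rw [hn]; exact walk_halfSites_succ_of_ne hne
  have e1 := leftProb_halfSites (L := L) hq (2 * t) (i := t + x) (j := t - x + 1)
    (by push_cast; ring)
  have e2 := rightProb_halfSites (L := L) hq (2 * t) (i := t + x) (j := t - x + 1)
    (by push_cast; ring)
  have e3 := leftProb_halfSites (L := L) hq n (i := t + x) (j := t - x) (by omega)
  have e4 := rightProb_halfSites (L := L) hq n (i := t + x) (j := t - x) (by omega)
  have e3' : leftProb q (halfSites L (2 * t)) (2 * x + 1) = leftProb q (halfSites L n) (2 * x + 1) := by
    rw [hn]; exact walk_halfSites_succ_of_ne hne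
  have e4' : rightProb q (halfSites L (2 * t)) (2 * x + 1) =
      rightProb q (halfSites L n) (2 * x + 1) := by
    rw [hn]; exact walk_halfSites_succ_of_ne hne
  rw [show (t : ℤ) + x - (t - x + 1) + 1 = 2 * x by ring] at e1 e2
  rw [show (t : ℤ) + x - (t - x) + 1 = 2 * x + 1 by ring] at e3 e4
  rw [← harc, ringRun_agree_arc hq (by omega) hs _ (by omega) (by push_cast at *; omega)
    (by push_cast at *; omega) (by push_cast at *; omega), e1, e2, e3', e4', e3, e4]
  have h := tail_rightTail_det hq (x := t - x + 1) (y := t + x) (by omega)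
  rw [show (t : ℤ) - x + 1 - 1 = t - x by ring,
    show (t : ℤ) - x + 1 + (t + x) = ((2 * t + 1 : ℕ) : ℤ) by push_cast; ring,
    zpow_natCast] at h
  rw [← h]
  simp

end Layers

/-! ### Averages over circuits -/

section Resample

variable {ι α M : Type*} [Fintype ι] [DecidableEq ι] [Fintype α] [AddCommMonoid M]

theorem sum_update_swap (i : ι) (H : (ι → α) → α → M) :
    ∑ G : ι → α, ∑ f, H G f = ∑ G : ι → α, ∑ f, H (Function.update G i f) (G i) := by
  rw [← Fintype.sum_prod_type', ← Fintype.sum_prod_type']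
  have hinv : Function.Involutive
      fun p : (ι → α) × α => (Function.update p.1 i p.2, p.1 i) := by
    rintro ⟨G, f⟩
    simp
  exact (Equiv.sum_comp hinv.toPerm fun p : (ι → α) × α => H p.1 p.2).symm

/-- The sum over one independent coordinate may be taken separately. -/
theorem card_nsmul_sum_eq (i : ι) (H : α → (ι → α) → M)
    (hH : ∀ f G f', H f (Function.update G i f') = H f G) :
    Fintype.card α • ∑ G : ι → α, H (G i) G = ∑ G : ι → α, ∑ f, H f G := by
  have := sum_update_swap i fun G f => H (G i) G
  simp only [Finset.sum_const, Finset.card_univ, Function.update_self, hH] at this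
  rw [Finset.smul_sum, this]

end Resample

/-! ### Reduction of the circuit average to a product of averaged gates -/

section RingAverage

variable {q N : ℕ}

/-- A configuration of the ring after the gates `G i` act on the sites `site i, site i + 1`;
the gates are listed from the latest to the earliest. -/
def flow {ι : Type*} (site : ι → ZMod N) (G : ι → GatePerm q) :
    List ι → (ZMod N → Fin q) → ZMod N → Fin q
  | [], s => s
  | i :: l, s => gateAct (site i) (site i + 1) (G i) (flow site G l s)

theorem flow_update {ι : Type*} [DecidableEq ι] (site : ι → ZMod N) (G : ι → GatePerm q) {i : ι}
    {l : List ι} (hi : i ∉ l) (f : GatePerm q) (s : ZMod N → Fin q) :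
    flow site (Function.update G i f) l s = flow site G l s := by
  induction l with
  | nil => rfl
  | cons j l ih =>
    rw [List.mem_cons, not_or] at hi
    rw [flow, flow, ih hi.2, Function.update_of_ne (Ne.symm hi.1)]

/-- The evolution of two copies of the ring. -/
def pairFlow {ι : Type*} (site : ι → ZMod N) (G : ι → GatePerm q) (l : List ι)
    (s : ZMod N → Leg q) : ZMod N → Leg q :=
  fun w => (flow site G l (fun w => (s w).1) w, flow site G l (fun w => (s w).2) w)

theorem pairFlow_cons {ι : Type*} (site : ι → ZMod N) (G : ι → GatePerm q) (i : ι) (l : List ι)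
    (s : ZMod N → Leg q) :
    pairFlow site G (i :: l) s = pairAct (site i) (site i + 1) (G i) (pairFlow site G l s) :=
  rfl

variable {K : Type*} [Field K]

/-- The average over independent, uniformly random gates. -/
theorem sum_pairFlow [CharZero K] {ι : Type*} [Fintype ι] [DecidableEq ι] (site : ι → ZMod N) {l : List ι}
    (hl : l.Nodup) (Φ : (ZMod N → Leg q) → K) (s : ZMod N → Leg q) :
    ∑ G : ι → GatePerm q, Φ (pairFlow site G l s) =
      (Fintype.card (ι → GatePerm q) : K) * ringRun K q N (l.map site) Φ s := by
  induction l generalizing Φ with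
  | nil =>
    simp only [List.map_nil, ringRun, Module.End.one_apply]
    have : ∀ G : ι → GatePerm q, pairFlow site G [] s = s := fun G => rfl
    simp only [this, Finset.sum_const, Finset.card_univ, nsmul_eq_mul]
  | cons i l ih =>
    rw [List.nodup_cons] at hl
    rw [List.map_cons, ringRun, Module.End.mul_apply, ← ih hl.2]
    have hN : (Fintype.card (GatePerm q) : K) ≠ 0 := by
      exact_mod_cast Fintype.card_ne_zero
    -- Each gate occurs once in the list, so the earlier evolution does not depend on gate `i`,
    -- which can be averaged separately.
    have hH : ∀ (G : ι → GatePerm q) (f' : GatePerm q),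
        pairFlow site (Function.update G i f') l s = pairFlow site G l s := by
      intro G f'
      funext w
      rw [pairFlow, pairFlow, flow_update site G hl.1, flow_update site G hl.1]
    have := card_nsmul_sum_eq (ι := ι) i
      (fun (f : GatePerm q) G => Φ (pairAct (site i) (site i + 1) f (pairFlow site G l s)))
      fun f G f' => by rw [hH]
    simp only [pairFlow_cons]
    refine mul_left_cancel₀ hN ?_
    rw [← nsmul_eq_mul, this, Finset.mul_sum]
    refine Finset.sum_congr rfl fun G _ => ?_
    rw [avgOp_apply, avgAct, mul_div_cancel₀ _ hN]

theorem ringRun_eq_zero (gs : List (ZMod N)) {Φ : (ZMod N → Leg q) → K}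
    (hΦ : ∀ s, (∀ w, (s w).1 = (s w).2) → Φ s = 0) {s : ZMod N → Leg q}
    (hs : ∀ w, (s w).1 = (s w).2) : ringRun K q N gs Φ s = 0 := by
  induction gs generalizing Φ with
  | nil => exact hΦ s hs
  | cons n gs ih =>
    rw [ringRun, Module.End.mul_apply]
    refine ih fun s hs => ?_
    rw [avgOp_apply, avgAct, Finset.sum_eq_zero, zero_div]
    intro f _
    refine hΦ _ fun w => ?_
    have : (fun w => (s w).1) = fun w => (s w).2 := funext hs
    simp only [pairAct, this]

/-- Gates that miss `y` fix all the observables involved; the latest gate that touches `y` makes the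
replacement. -/
theorem ringRun_opAgree [CharZero K] (hq : 2 ≤ q) (hN : 1 < N) {gs : List (ZMod N)} {y : ZMod N}
    (hy : ∃ n ∈ gs, y = n ∨ y = n + 1) (O : Fin q → Fin q → K) (hO : ∑ i, O i i = 0) :
    ringRun K q N gs (opAgree y ∅ O) = ((∑ i, ∑ j, O i j) / (q * (q - 1))) •
      ringRun K q N gs (agree K {y} - agree K ∅) := by
  have : Fact (1 < N) := ⟨hN⟩
  induction gs with
  | nil => simp at hy
  | cons n gs ih =>
    rw [ringRun, Module.End.mul_apply, Module.End.mul_apply]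
    by_cases hn : y = n ∨ y = n + 1
    · rw [avgOp_opAgree_of_trace_eq_zero hq (by simp) hn O hO, map_smul]
    · have h1 : n ≠ y := fun h => hn (Or.inl h.symm)
      have h2 : n + 1 ≠ y := fun h => hn (Or.inr h.symm)
      rw [avgOp_opAgree_of_ne (by simp) h1 h2, map_sub,
        avgOp_agree_of_iff (by simp) (by simp [h1, h2]), avgOp_agree_of_iff (by simp) (by simp)]
      refine ih ?_
      obtain ⟨m, hm, hym⟩ := hy
      rcases List.mem_cons.1 hm with rfl | hm
      · exact absurd hym hn
      · exact ⟨m, hm, hym⟩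

theorem ringRun_ofReal (gs : List (ZMod N)) (Φ : (ZMod N → Leg q) → ℝ) (s : ZMod N → Leg q) :
    ringRun ℂ q N gs (fun s => (Φ s : ℂ)) s = (ringRun ℝ q N gs Φ s : ℝ) := by
  induction gs generalizing Φ with
  | nil => rfl
  | cons n gs ih =>
    rw [ringRun, Module.End.mul_apply, ringRun, Module.End.mul_apply, ← ih]
    refine congrArg (fun Ψ => ringRun ℂ q N gs Ψ s) ?_
    funext s
    simp [avgOp_apply, avgAct]

theorem agree_ofReal {W : Type*} (S : Set W) (s : W → Leg q) :
    agree ℂ S s = (agree ℝ S s : ℝ) := by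
  simp only [agree]
  split_ifs <;> simp

end RingAverage

/-! ### The evolution operator as a permutation of configurations -/

section Evolution

variable {q L : ℕ}

/-- The matrix of a map of the computational basis. -/
def mapMatrix {X : Type*} [DecidableEq X] (F : X → X) : Matrix X X ℂ :=
  Matrix.of fun a b => if F b = a then 1 else 0

theorem mapMatrix_apply {X : Type*} [DecidableEq X] (F : X → X) (a b : X) :
    mapMatrix F a b = if F b = a then 1 else 0 := rfl

theorem mapMatrix_id {X : Type*} [DecidableEq X] : mapMatrix (fun a : X => a) = 1 := by
  ext a b
  simp [mapMatrix_apply, Matrix.one_apply, eq_comm]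

theorem mapMatrix_mul {X : Type*} [Fintype X] [DecidableEq X] (F G : X → X) :
    mapMatrix F * mapMatrix G = mapMatrix fun a => F (G a) := by
  ext a b
  simp [mapMatrix_apply, Matrix.mul_apply]

theorem twoSite_gateMatrix [NeZero L] (n : ZMod (2 * L)) (f : GatePerm q) :
    twoSite n (gateMatrix ℂ f) =
      mapMatrix (gateAct n (n + 1) f : Config q L → Config q L) := by
  have hL : 1 < 2 * L := by have := NeZero.pos L; omega
  have : Fact (1 < 2 * L) := ⟨hL⟩
  have hn : n ≠ n + 1 := by simp
  ext a b
  rw [mapMatrix_apply]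
  simp only [twoSite, gateMatrix, Matrix.of_apply]
  rw [← ite_and]
  refine if_congr ?_ rfl rfl
  constructor
  · rintro ⟨h1, h2⟩
    funext m
    rw [gateAct]
    by_cases hm1 : m = n + 1
    · subst hm1; simp [h2]
    by_cases hm0 : m = n
    · subst hm0; simp [h2]
    · simp [hm0, hm1, h1 m hm0 hm1]
  · rintro rfl
    refine ⟨fun m hm0 hm1 => ?_, ?_⟩
    · simp [gateAct, hm0, hm1]
    · simp [gateAct, hn]

/-- The left site of a gate of a circuit. -/
def gateSite {t : ℕ} (L : ℕ) (i : Fin t × Fin 2 × Fin L) : ZMod (2 * L) :=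
  ((2 * (i.2.2 : ℕ) + (i.2.1 : ℕ) : ℕ) : ZMod (2 * L))

/-- The gates of a circuit, from the latest to the earliest. -/
def gateList (L t : ℕ) : List (Fin t × Fin 2 × Fin L) :=
  (List.finRange t).reverse.flatMap fun τ =>
    (List.finRange L).map (fun j => (τ, 1, j)) ++ (List.finRange L).map (fun j => (τ, 0, j))

theorem nodup_gateList (L t : ℕ) : (gateList L t).Nodup := by
  rw [gateList, List.nodup_flatMap]
  constructor
  · intro τ _
    refine List.Nodup.append ?_ ?_ ?_
    · exact (List.nodup_finRange L).map fun a b h => by simpa using h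
    · exact (List.nodup_finRange L).map fun a b h => by simpa using h
    · intro a h1 h2
      simp only [List.mem_map] at h1 h2
      obtain ⟨j, _, rfl⟩ := h1
      obtain ⟨k, _, h⟩ := h2
      simp at h
  · have : (List.finRange t).reverse.Nodup := List.nodup_reverse.2 (List.nodup_finRange t)
    refine List.Pairwise.imp ?_ this
    intro a b hab c h1 h2
    simp only [List.mem_append, List.mem_map] at h1 h2
    rcases h1 with ⟨j, _, rfl⟩ | ⟨j, _, rfl⟩ <;> rcases h2 with ⟨k, _, h⟩ | ⟨k, _, h⟩ <;>
      simp at h <;> exact hab h.1.symm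

theorem map_gateSite_gateList (L t : ℕ) :
    (gateList L t).map (gateSite L) = halfSites L (2 * t) := by
  have key : ∀ l : List (Fin t), (l.flatMap fun τ =>
      (List.finRange L).map (fun j => ((τ, 1, j) : Fin t × Fin 2 × Fin L)) ++
        (List.finRange L).map (fun j => (τ, 0, j))).map (gateSite L) =
      halfSites L (2 * l.length) := by
    intro l
    induction l with
    | nil => rfl
    | cons a l ih =>
      rw [List.flatMap_cons, List.map_append, ih, List.length_cons,
        show 2 * (l.length + 1) = 2 * l.length + 1 + 1 by ring, halfSites, halfSites,
        ← List.append_assoc]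
      congr 1
      rw [List.map_append, List.map_map, List.map_map]
      simp [layerSites, List.ofFn_eq_map, gateSite, Function.comp_def, Nat.add_mod]
  rw [gateList, key]
  simp

theorem prod_twoSite_eq [NeZero L] {ι : Type*} (site : ι → ZMod (2 * L)) (G : ι → GatePerm q)
    (l : List ι) : (l.map fun i => twoSite (site i) (gateMatrix ℂ (G i))).prod =
      mapMatrix (flow site G l : Config q L → Config q L) := by
  induction l with
  | nil => exact mapMatrix_id.symm
  | cons i l ih =>
    rw [List.map_cons, List.prod_cons, ih, twoSite_gateMatrix, mapMatrix_mul]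
    rfl

theorem evolution_eq [NeZero L] {t : ℕ} (G : Circuit q L t) :
    evolution G = mapMatrix (flow (gateSite L) G (gateList L t) : Config q L → Config q L) := by
  rw [← prod_twoSite_eq, gateList, evolution, List.ofFn_eq_map, ← List.map_reverse]
  induction (List.finRange t).reverse with
  | nil => rfl
  | cons τ l ih =>
    rw [List.map_cons, List.prod_cons, ih, List.flatMap_cons, List.map_append, List.map_append,
      List.prod_append, List.prod_append]
    congr 1
    rw [timeStep, halfStep, halfStep]
    simp only [List.ofFn_eq_map, List.map_map]
    rfl

theorem oneSite_apply [NeZero L] (n : ZMod (2 * L)) (O : Matrix (Fin q) (Fin q) ℂ)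
    (a b : Config q L) : oneSite n O a b = opAgree n ∅ O (fun w => (a w, b w)) := by
  simp only [oneSite, opAgree, Matrix.of_apply]
  simp

/-- Conjugation by the matrix of a basis map `F` turns the entry at `(a, b)` into the entry at `(F
a, F b)`, so the row and column indices evolve as two copies. -/
theorem corr_eq [NeZero L] {t : ℕ} (G : Circuit q L t) (Oμ Oν : Matrix (Fin q) (Fin q) ℂ) (x : ℤ) :
    corr G Oμ Oν x = (∑ a : Config q L, ∑ b : Config q L,
      opAgree ((2 * x : ℤ) : ZMod (2 * L)) ∅ Oμ
        (pairFlow (gateSite L) G (gateList L t) fun w => (a w, b w)) * oneSite 0 Oν b a) /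
        (Fintype.card (Config q L) : ℂ) := by
  rw [corr, Matrix.trace_one, heisenberg, evolution_eq]
  congr 1
  rw [Matrix.trace]
  refine Finset.sum_congr rfl fun a _ => ?_
  rw [Matrix.diag_apply, Matrix.mul_apply]
  refine Finset.sum_congr rfl fun b _ => ?_
  congr 1
  simp only [Matrix.mul_apply, Matrix.conjTranspose_apply, mapMatrix_apply, oneSite_apply]
  simp
  rfl

end Evolution

/-! ### The averaged two-point function -/

section TwoPoint

variable {q L : ℕ}

theorem sum_agree_off [NeZero L] (a : Config q L) (g : Fin q → ℂ) :
    (∑ b : Config q L, if ∀ m, m ≠ 0 → b m = a m then g (b 0) else 0) = ∑ v, g v := by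
  rw [← Finset.sum_filter]
  refine Finset.sum_nbij' (fun b => b 0) (fun v => Function.update a 0 v) ?_ ?_ ?_ ?_ ?_
  · simp
  · intro v _
    simp only [Finset.mem_filter, Finset.mem_univ, true_and]
    intro m hm
    simp [hm]
  · intro b hb
    simp only [Finset.mem_filter, Finset.mem_univ, true_and] at hb
    funext m
    by_cases hm : m = 0
    · subst hm; simp
    · simp [hm, hb m hm]
  · simp
  · simp

theorem mul_sum_apply_zero [NeZero L] (h : Fin q → ℂ) :
    (q : ℂ) * ∑ a : Config q L, h (a 0) = (Fintype.card (Config q L) : ℂ) * ∑ u, h u := by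
  have := card_nsmul_sum_eq (ι := ZMod (2 * L)) (α := Fin q) 0 (fun f _ => h f) (fun _ _ _ => rfl)
  simpa using this

/-- `Oν` forces the copies to agree away from site `0`. Identical copies contribute nothing, and
copies that differ at `0` all contribute the same probability. Only the off-diagonal entries of `Oν`
remain, and their sum is the full sum since the trace is zero. -/
theorem avgCorr_eq [NeZero L] (hq : 2 ≤ q) {t : ℕ} {Oμ Oν : Matrix (Fin q) (Fin q) ℂ} {x : ℤ}
    (hμ : Oμ.trace = 0) (hν : Oν.trace = 0) (ht : 1 ≤ t) (htL : 2 * t ≤ L)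
    (hx1 : -(L : ℤ) < 2 * x) (hx2 : 2 * x ≤ L) :
    avgCorr q L t Oμ Oν x = (∑ i, ∑ j, Oμ i j) * (∑ i, ∑ j, Oν i j) / (q ^ 2 * (q - 1)) *
      (((1 + q) * (q / (1 + q) ^ 2 : ℝ) ^ (2 * t + 1) *
        (A (t - x + 1) (t + x) (α q) * A (t + x - 1) (t - x + 1) (α q) -
          A (t - x + 1) (t + x - 1) (α q) * A (t + x) (t - x + 1) (α q)) : ℝ) : ℂ) := by
  set P : ℝ := (1 + q) * (q / (1 + q) ^ 2 : ℝ) ^ (2 * t + 1) *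
        (A (t - x + 1) (t + x) (α q) * A (t + x - 1) (t - x + 1) (α q) -
          A (t - x + 1) (t + x - 1) (α q) * A (t + x) (t - x + 1) (α q)) with hP
  set y : ZMod (2 * L) := ((2 * x : ℤ) : ZMod (2 * L)) with hy
  set c : ℂ := (∑ i, ∑ j, Oμ i j) / (q * (q - 1)) with hc
  have hq0 : (q : ℂ) ≠ 0 := by
    have : q ≠ 0 := by omega
    exact_mod_cast this
  have hC : (Fintype.card (Circuit q L t) : ℂ) ≠ 0 := by
    exact_mod_cast Fintype.card_ne_zero
  have : Nonempty (Fin q) := ⟨⟨0, by omega⟩⟩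
  have hD : (Fintype.card (Config q L) : ℂ) ≠ 0 := by
    exact_mod_cast Fintype.card_ne_zero
  have htouch : ∃ n ∈ halfSites L (2 * t), y = n ∨ y = n + 1 := by
    obtain ⟨n, hn, h⟩ := exists_cut (L := L) (h := 1) (u := 2 * x) (by push_cast; omega)
    refine ⟨n, ?_, Or.inr h⟩
    obtain ⟨m, rfl⟩ : ∃ m, t = m + 1 := ⟨t - 1, by omega⟩
    rw [show 2 * (m + 1) = 2 * m + 1 + 1 by ring, halfSites]
    refine List.mem_append_left _ ?_
    rwa [show (2 * m + 1) % 2 = 1 by omega]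
  have hval : ∀ a b : Config q L,
      ringRun ℂ q (2 * L) (halfSites L (2 * t)) (opAgree y ∅ Oμ) (fun w => (a w, b w)) *
        oneSite 0 Oν b a =
      if ∀ m, m ≠ 0 → b m = a m then (if b 0 = a 0 then 0 else Oν (b 0) (a 0)) * (c * P)
      else 0 := by
    intro a b
    simp only [oneSite, Matrix.of_apply]
    split_ifs with h1 h2
    · rw [ringRun_opAgree hq (by omega) htouch Oμ (by simpa [Matrix.trace] using hμ),
        Pi.smul_apply, ringRun_eq_zero]
      · simp
      · intro s hs
        simp [agree, hs]
      · intro w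
        by_cases hw : w = 0
        · subst hw; exact h2.symm
        · exact (h1 w hw).symm
    · have hs : ∀ w, ((fun w => (a w, b w)) w : Leg q).1 = ((fun w => (a w, b w)) w : Leg q).2 ↔
          w ≠ 0 := by
        intro w
        constructor
        · rintro h rfl
          exact h2 h.symm
        · intro h
          exact (h1 w h).symm
      have e1 := ringRun_agree_singleton hq ht htL hx1 hx2 hs
      have e2 := ringRun_agree_empty (by omega) (halfSites L (2 * t)) fun w => (a w, b w)
      have e3 : agree ℝ ∅ (fun w => (a w, b w)) = 0 := by
        simp only [agree]
        rw [if_neg]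
        intro h
        exact h2 (h 0 (by simp)).symm
      have e4 : (agree ℂ {y} - agree ℂ ∅ : (ZMod (2 * L) → Leg q) → ℂ) =
          fun s => ((agree ℝ {y} s - agree ℝ ∅ s : ℝ) : ℂ) := by
        funext s
        simp [agree_ofReal]
      have e5 : (fun s : ZMod (2 * L) → Leg q => agree ℝ {y} s - agree ℝ ∅ s) =
          agree ℝ {y} - agree ℝ ∅ := rfl
      rw [ringRun_opAgree hq (by omega) htouch Oμ (by simpa [Matrix.trace] using hμ),
        Pi.smul_apply, e4, ringRun_ofReal, e5, map_sub, Pi.sub_apply, e2, e3, e1, sub_zero,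
        smul_eq_mul, mul_comm]
    · simp
  have hsum : ∑ G : Circuit q L t, corr G Oμ Oν x =
      (Fintype.card (Circuit q L t) : ℂ) * ((∑ a : Config q L, ∑ b : Config q L,
        ringRun ℂ q (2 * L) (halfSites L (2 * t)) (opAgree y ∅ Oμ) (fun w => (a w, b w)) *
          oneSite 0 Oν b a) / (Fintype.card (Config q L) : ℂ)) := by
    simp only [corr_eq]
    rw [← Finset.sum_div, mul_div_assoc', Finset.sum_comm, Finset.mul_sum]
    congr 1
    refine Finset.sum_congr rfl fun a _ => ?_
    rw [Finset.sum_comm, Finset.mul_sum]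
    refine Finset.sum_congr rfl fun b _ => ?_
    rw [← Finset.sum_mul, sum_pairFlow (gateSite L) (nodup_gateList L t), map_gateSite_gateList,
      mul_assoc]
  have hoff : ∑ u, ∑ v, (if v = u then 0 else Oν v u) = ∑ i, ∑ j, Oν i j := by
    have : ∀ u v, (if v = u then 0 else Oν v u) = Oν v u - if v = u then Oν v u else 0 := by
      intro u v; split_ifs <;> simp
    simp only [this, Finset.sum_sub_distrib, Finset.sum_ite_eq', Finset.mem_univ, if_true]
    have h0 : ∑ u, Oν u u = 0 := by simpa [Matrix.trace] using hν
    rw [h0, sub_zero, Finset.sum_comm]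
  have hfin := mul_sum_apply_zero (L := L) (q := q)
    fun u => ∑ v, (if v = u then 0 else Oν v u) * (c * P)
  rw [avgCorr, hsum, mul_div_cancel_left₀ _ hC]
  simp only [hval]
  have hstep : ∀ a : Config q L, (∑ b : Config q L, if ∀ m, m ≠ 0 → b m = a m then
      (if b 0 = a 0 then 0 else Oν (b 0) (a 0)) * (c * P) else 0) =
      ∑ v, (if v = a 0 then 0 else Oν v (a 0)) * (c * P) := fun a =>
    sum_agree_off a fun v => (if v = a 0 then 0 else Oν v (a 0)) * (c * P)
  simp only [hstep]
  simp only [← Finset.sum_mul] at hfin ⊢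
  rw [hoff] at hfin
  have hq1 : (q : ℂ) - 1 ≠ 0 := by
    rw [sub_ne_zero]
    have : q ≠ 1 := by omega
    exact_mod_cast this
  rw [div_eq_iff hD]
  refine mul_left_cancel₀ hq0 ?_
  rw [hfin, hc]
  field_simp

theorem sqrt_div_pow (q k : ℕ) :
    (Real.sqrt q / (1 + q) : ℝ) ^ (2 * k) = (q / (1 + q) ^ 2 : ℝ) ^ k := by
  rw [pow_mul, div_pow, Real.sq_sqrt (Nat.cast_nonneg q)]

theorem opSum_mul_opSum (Oμ Oν : Matrix (Fin q) (Fin q) ℂ) :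
    opSum Oμ * opSum Oν = (∑ i, ∑ j, Oμ i j) * (∑ i, ∑ j, Oν i j) / (q : ℂ) ^ 3 := by
  have h : ((q : ℝ) ^ (-(3 / 2) : ℝ)) * ((q : ℝ) ^ (-(3 / 2) : ℝ)) = ((q : ℝ) ^ 3)⁻¹ := by
    rw [← Real.mul_rpow (Nat.cast_nonneg q) (Nat.cast_nonneg q), ← sq, ← Real.rpow_natCast,
      ← Real.rpow_mul (Nat.cast_nonneg q)]
    rw [show ((2 : ℕ) : ℝ) * (-(3 / 2)) = -((3 : ℕ) : ℝ) by norm_num,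
      Real.rpow_neg (Nat.cast_nonneg q), Real.rpow_natCast]
  have h' := congrArg (fun r : ℝ => (r : ℂ)) h
  rw [Complex.ofReal_mul, Complex.ofReal_inv, Complex.ofReal_pow, Complex.ofReal_natCast] at h'
  rw [opSum, opSum, div_eq_mul_inv _ ((q : ℂ) ^ 3), ← h']
  generalize (((q : ℝ) ^ (-(3 / 2) : ℝ) : ℝ) : ℂ) = r
  ring

/-- The averaged two-point function of random permutation circuits. -/
theorem avgCorr_eq_opSum [NeZero L] (hq : 2 ≤ q) {t : ℕ} {Oμ Oν : Matrix (Fin q) (Fin q) ℂ}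
    {x : ℤ} (hμ : Oμ.trace = 0) (hν : Oν.trace = 0) (ht : 1 ≤ t) (htL : 2 * t ≤ L)
    (hx1 : -(L : ℤ) < 2 * x) (hx2 : 2 * x ≤ L) :
    avgCorr q L t Oμ Oν x =
        opSum Oμ * opSum Oν / (1 - (q : ℂ) ^ (-2 : ℤ)) *
          ((Real.sqrt q / (1 + q) : ℝ) : ℂ) ^ (4 * t) *
          ((A (t - x + 1) (t + x) (α q) * A (t + x - 1) (t - x + 1) (α q) -
            A (t - x + 1) (t + x - 1) (α q) * A (t + x) (t - x + 1) (α q) : ℝ) : ℂ) := by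
  rw [avgCorr_eq hq hμ hν ht htL hx1 hx2, opSum_mul_opSum, ← Complex.ofReal_pow,
    show 4 * t = 2 * (2 * t) by ring, sqrt_div_pow, pow_succ (q / (1 + q) ^ 2 : ℝ)]
  have hq0 : (q : ℂ) ≠ 0 := by
    have : q ≠ 0 := by omega
    exact_mod_cast this
  have hq1 : (q : ℂ) - 1 ≠ 0 := by
    rw [sub_ne_zero]
    have : q ≠ 1 := by omega
    exact_mod_cast this
  have hq2 : (1 : ℂ) + q ≠ 0 := by
    have : 1 + q ≠ 0 := by omega
    exact_mod_cast this
  have e : (1 - (q : ℂ) ^ (-2 : ℤ)) = (q - 1) * (1 + q) / q ^ 2 := by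
    rw [zpow_neg, zpow_ofNat]
    field_simp
    ring
  rw [e, Complex.ofReal_mul, Complex.ofReal_mul, Complex.ofReal_mul]
  generalize (((A (t - x + 1) (t + x) (α q) * A (t + x - 1) (t - x + 1) (α q) -
            A (t - x + 1) (t + x - 1) (α q) * A (t + x) (t - x + 1) (α q) : ℝ)) : ℂ) = B
  generalize ((((q / (1 + q) ^ 2 : ℝ) ^ (2 * t) : ℝ)) : ℂ) = E
  push_cast
  field_simp

end TwoPoint

/-! ### The rectangular network as a composition of averaged gates -/

section Network

variable {q : ℕ}

theorem avgAct_eq_sum_avgGate {W : Type*} [DecidableEq W] {l r : W} (hlr : l ≠ r)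
    (Φ : (W → Leg q) → ℝ) (s : W → Leg q) :
    avgAct l r Φ s = ∑ a : Leg q, ∑ b : Leg q, avgGate (a, b) (s l, s r) *
      Φ (Function.update (Function.update s l a) r b) := by
  have hcard : (Fintype.card (GatePerm q) : ℝ) = (Nat.factorial (q ^ 2) : ℝ) := by
    rw [Fintype.card_perm, Fintype.card_prod, Fintype.card_fin, sq]
  have key : ∀ f : GatePerm q, Φ (pairAct l r f s) = ∑ a : Leg q, ∑ b : Leg q,
      (gateMatrix ℝ f (a.1, b.1) ((s l).1, (s r).1) *
        gateMatrix ℝ f (a.2, b.2) ((s l).2, (s r).2)) *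
        Φ (Function.update (Function.update s l a) r b) := by
    intro f
    rw [Finset.sum_eq_single (pairAct l r f s l), Finset.sum_eq_single (pairAct l r f s r)]
    · have : Function.update (Function.update s l (pairAct l r f s l)) r (pairAct l r f s r) =
          pairAct l r f s := by
        funext w
        by_cases h1 : w = r
        · subst h1; simp
        by_cases h2 : w = l
        · subst h2; simp [h1]
        · simp [h1, h2, pairAct_of_ne h2 h1]
      rw [this, pairAct_left hlr, pairAct_right]
      simp [gateMatrix]
    · intro b _ hb
      rw [pairAct_right] at hb
      rw [pairAct_left hlr]
      simp only [gateMatrix, Matrix.of_apply]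
      rw [ite_zero_mul_ite_zero, if_neg, zero_mul]
      rintro ⟨h1, h2⟩
      rw [h1, h2] at hb
      exact hb rfl
    · simp
    · intro a _ ha
      refine Finset.sum_eq_zero fun b _ => ?_
      rw [pairAct_left hlr] at ha
      simp only [gateMatrix, Matrix.of_apply]
      rw [ite_zero_mul_ite_zero, if_neg, zero_mul]
      rintro ⟨h1, h2⟩
      rw [h1, h2] at ha
      exact ha rfl
    · simp
  simp only [avgAct, key, avgGate, hcard, Finset.sum_div, Finset.sum_mul]
  rw [Finset.sum_comm]
  refine Finset.sum_congr rfl fun a _ => ?_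
  rw [Finset.sum_comm]
  refine Finset.sum_congr rfl fun b _ => Finset.sum_congr rfl fun f _ => ?_
  ring

theorem sum_cons {α M : Type*} [Fintype α] [AddCommMonoid M] {n : ℕ} (g : (Fin (n + 1) → α) → M) :
    ∑ e, g e = ∑ a, ∑ e : Fin n → α, g (Fin.cons a e) := by
  rw [← Fintype.sum_prod_type']
  exact (Equiv.sum_comp (Fin.consEquiv fun _ : Fin (n + 1) => α) g).symm

theorem sum_snoc {α M : Type*} [Fintype α] [AddCommMonoid M] {n : ℕ} (g : (Fin (n + 1) → α) → M) :
    ∑ e, g e = ∑ a, ∑ e : Fin n → α, g (Fin.snoc e a) := by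
  rw [← Fintype.sum_prod_type']
  exact (Equiv.sum_comp (Fin.snocEquiv fun _ : Fin (n + 1) => α) g).symm

theorem pairAct_cons {y : ℕ} (l r : Fin y) (f : GatePerm q) (b : Leg q) (s : Fin y → Leg q) :
    pairAct l.succ r.succ f (Fin.cons b s : Fin (y + 1) → Leg q) =
      Fin.cons b (pairAct l r f s) := by
  funext w
  refine Fin.cases ?_ (fun w => ?_) w
  · rw [pairAct_of_ne (Fin.succ_ne_zero l).symm (Fin.succ_ne_zero r).symm]
    simp
  · simp [pairAct, gateAct, Function.update_apply]

/-- Slot `0` is a spectator for the gates on the other slots. This drives the induction along a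
column, since slot `0` is final after the first gate. -/
theorem prod_avgOp_cons {y : ℕ} (gs : List (Fin y × Fin y)) (b : Leg q)
    (Φ : (Fin (y + 1) → Leg q) → ℝ) (s : Fin y → Leg q) :
    (gs.map fun g => avgOp (K := ℝ) (q := q) g.1.succ g.2.succ).prod Φ (Fin.cons b s) =
      (gs.map fun g => avgOp g.1 g.2).prod (fun s => Φ (Fin.cons b s)) s := by
  induction gs generalizing s with
  | nil => rfl
  | cons g gs ih =>
    simp only [List.map_cons, List.prod_cons, Module.End.mul_apply]
    rw [avgOp_apply, avgAct, avgOp_apply, avgAct]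
    simp only [pairAct_cons, ih]

/-- The gates of a column of the network, as pairs of slots. Slot `0` carries the lower right leg
of the column, slot `j + 1` the `j`-th lower left leg. -/
def colGates (y : ℕ) : List (Fin (y + 1) × Fin (y + 1)) :=
  (List.finRange y).map fun j => (j.succ, j.castSucc)

/-- The averaged evolution of observables by the first `j` gates of a column. -/
noncomputable def colRun (q y j : ℕ) : Module.End ℝ ((Fin (y + 1) → Leg q) → ℝ) :=
  (((colGates y).take j).map fun g => avgOp g.1 g.2).prod

theorem colRun_zero (y : ℕ) : colRun q y 0 = 1 := by
  simp [colRun]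

theorem colRun_succ {y j : ℕ} (hj : j < y) : colRun q y (j + 1) =
    colRun q y j * avgOp (Fin.succ ⟨j, hj⟩) (Fin.castSucc ⟨j, hj⟩) := by
  rw [colRun, colRun, List.take_succ_eq_append_getElem (by simpa [colGates] using hj),
    List.map_append, List.prod_append]
  simp [colGates]

theorem colRun_self (y : ℕ) :
    colRun q y y = ((colGates y).map fun g => avgOp g.1 g.2).prod := by
  rw [colRun, List.take_of_length_le (by simp [colGates])]

theorem colGates_succ (y : ℕ) : colGates (y + 1) =
    (Fin.succ 0, Fin.castSucc 0) :: (colGates y).map fun g => (g.1.succ, g.2.succ) := by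
  simp [colGates, List.finRange_succ]

/-- The sum over the inner legs of a column of the network. -/
theorem sum_column_eq_colRun (y : ℕ) (Φ : (Fin (y + 1) → Leg q) → ℝ) (e₀ : Leg q)
    (F : Fin y → Leg q) :
    ∑ e : Fin y → Leg q, ∑ f : Fin y → Leg q,
      (∏ j : Fin y, avgGate (e j, f j) (F j, (Fin.cons e₀ e : Fin (y + 1) → Leg q) j.castSucc)) *
        Φ (Fin.snoc f ((Fin.cons e₀ e : Fin (y + 1) → Leg q) (Fin.last y))) =
      colRun q y y Φ (Fin.cons e₀ F) := by
  induction y generalizing e₀ with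
  | zero =>
    rw [colRun_zero, Module.End.one_apply]
    simp only [Finset.univ_unique, Finset.sum_singleton, Finset.univ_eq_empty, Finset.prod_empty,
      one_mul]
    congr 1
    funext k
    fin_cases k
    rfl
  | succ y ih =>
    rw [colRun_self, colGates_succ, List.map_cons, List.prod_cons, Module.End.mul_apply,
      avgOp_apply, avgAct_eq_sum_avgGate (by simp), sum_cons]
    refine Finset.sum_congr rfl fun e₁ _ => ?_
    -- After the first gate, slot `0` holds its upper right leg `b` and slot `1` the leg `e₁` that
    -- enters the next gate; from slot `1` on this is a shorter column with inlet `e₁`.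
    have hup : ∀ b : Leg q, Function.update (Function.update
        (Fin.cons e₀ F : Fin (y + 2) → Leg q) (Fin.succ 0) e₁) (Fin.castSucc 0) b =
        Fin.cons b (Fin.cons e₁ (Fin.tail F) : Fin (y + 1) → Leg q) := by
      intro b
      funext k
      refine Fin.cases ?_ (fun k => ?_) k
      · simp
      · refine Fin.cases ?_ (fun k => ?_) k
        · simp
        · rw [Function.update_of_ne (by simp [Fin.ext_iff]),
            Function.update_of_ne (by simp [Fin.ext_iff])]
          simp [Fin.tail]
    have e2 : ∀ b : Leg q, ((List.map (fun g : Fin (y + 1) × Fin (y + 1) => (g.1.succ, g.2.succ))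
        (colGates y)).map fun g => avgOp (K := ℝ) (q := q) g.1 g.2).prod Φ
          (Fin.cons b (Fin.cons e₁ (Fin.tail F) : Fin (y + 1) → Leg q)) =
        colRun q y y (fun s => Φ (Fin.cons b s)) (Fin.cons e₁ (Fin.tail F)) := by
      intro b
      rw [List.map_map, colRun_self]
      exact prod_avgOp_cons (colGates y) b Φ _
    simp only [hup, e2]
    simp only [← ih]
    have e3 : ∀ e : Fin y → Leg q, ∑ f : Fin (y + 1) → Leg q,
        (∏ j : Fin (y + 1), avgGate ((Fin.cons e₁ e : Fin (y + 1) → Leg q) j, f j)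
          (F j, (Fin.cons e₀ (Fin.cons e₁ e : Fin (y + 1) → Leg q) :
            Fin (y + 2) → Leg q) j.castSucc)) *
        Φ (Fin.snoc f ((Fin.cons e₀ (Fin.cons e₁ e : Fin (y + 1) → Leg q) :
            Fin (y + 2) → Leg q) (Fin.last (y + 1)))) =
        ∑ b : Leg q, ∑ f : Fin y → Leg q, avgGate (e₁, b) (F 0, e₀) *
          ((∏ j : Fin y, avgGate (e j, f j)
            (Fin.tail F j, (Fin.cons e₁ e : Fin (y + 1) → Leg q) j.castSucc)) *
          Φ (Fin.cons b (Fin.snoc f ((Fin.cons e₁ e : Fin (y + 1) → Leg q) (Fin.last y)) :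
            Fin (y + 1) → Leg q))) := by
      intro e
      rw [sum_cons]
      refine Finset.sum_congr rfl fun b _ => Finset.sum_congr rfl fun f _ => ?_
      rw [Fin.prod_univ_succ, mul_assoc, ← Fin.succ_last, Fin.cons_succ,
        ← Fin.cons_snoc_eq_snoc_cons]
      simp only [Fin.cons_zero, Fin.cons_succ, Fin.castSucc_zero, ← Fin.succ_castSucc, Fin.tail]
    simp only [e3]
    rw [Finset.sum_comm]
    refine Finset.sum_congr rfl fun b _ => ?_
    rw [Finset.mul_sum]
    refine Finset.sum_congr rfl fun e _ => ?_
    rw [Finset.mul_sum]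
    simp

variable {y : ℕ}

/-- Contraction of the lower right leg of a column with the state `b`. -/
def inlet (b : Leg q → ℝ) : ((Fin (y + 1) → Leg q) → ℝ) →ₗ[ℝ] ((Fin y → Leg q) → ℝ) where
  toFun Φ F := ∑ e, b e * Φ (Fin.cons e F)
  map_add' Φ Ψ := by funext F; simp [mul_add, Finset.sum_add_distrib]
  map_smul' c Φ := by funext F; simp [Finset.mul_sum, mul_left_comm]

/-- Contraction of the upper left leg of a column with the state `t`. -/
def outlet (t : Leg q → ℝ) : ((Fin y → Leg q) → ℝ) →ₗ[ℝ] ((Fin (y + 1) → Leg q) → ℝ) where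
  toFun Φ s := t (s (Fin.last y)) * Φ (Fin.init s)
  map_add' Φ Ψ := by funext F; simp [mul_add]
  map_smul' c Φ := by funext F; simp [mul_left_comm]

/-- The contraction of the first `i` columns with the states `b` on the lower right legs and `t` on
the upper left legs. -/
noncomputable def columns (y : ℕ) (b t : ℕ → Leg q → ℝ) : ℕ → ((Fin y → Leg q) → ℝ) →ₗ[ℝ] ℝ
  | 0 =>
    { toFun Φ := ∑ F : Fin y → Leg q, (∏ j, circ (F j)) * Φ F
      map_add' Φ Ψ := by simp [mul_add, Finset.sum_add_distrib]
      map_smul' c Φ := by simp [Finset.mul_sum, mul_left_comm] }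
  | i + 1 => columns y b t i ∘ₗ inlet (b i) ∘ₗ colRun q y y ∘ₗ outlet (t i)

theorem sum_column (b t : Leg q → ℝ) (Φ : (Fin y → Leg q) → ℝ) (F : Fin y → Leg q) :
    ∑ e : Fin (y + 1) → Leg q, ∑ f : Fin y → Leg q,
      (∏ j : Fin y, avgGate (e j.succ, f j) (F j, e j.castSucc)) * b (e 0) * t (e (Fin.last y)) *
        Φ f =
      inlet b (colRun q y y (outlet t Φ)) F := by
  rw [sum_cons]
  refine Finset.sum_congr rfl fun e₀ _ => ?_
  rw [← sum_column_eq_colRun, Finset.mul_sum]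
  refine Finset.sum_congr rfl fun e _ => ?_
  rw [Finset.mul_sum]
  refine Finset.sum_congr rfl fun f _ => ?_
  simp only [outlet, LinearMap.coe_mk, AddHom.coe_mk, Fin.snoc_last, Fin.init_snoc, Fin.cons_succ,
    Fin.cons_zero]
  ring

/-- `Φ` is left general so that the induction can absorb the last column into it. -/
theorem sum_network (b t : ℕ → Leg q → ℝ) (x : ℕ) (Φ : (Fin y → Leg q) → ℝ) :
    ∑ e : Fin x → Fin (y + 1) → Leg q, ∑ f : Fin (x + 1) → Fin y → Leg q,
      (∏ i : Fin x, ∏ j : Fin y,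
        avgGate (e i j.succ, f i.succ j) (f i.castSucc j, e i j.castSucc)) *
      (∏ i : Fin x, b i (e i 0)) * (∏ j : Fin y, circ (f 0 j)) *
      (∏ i : Fin x, t i (e i (Fin.last y))) * Φ (f (Fin.last x)) = columns y b t x Φ := by
  induction x generalizing Φ with
  | zero =>
    simp only [Finset.univ_unique, Finset.sum_singleton, Finset.univ_eq_empty, Finset.prod_empty,
      one_mul, mul_one, columns, LinearMap.coe_mk, AddHom.coe_mk]
    rw [sum_cons]
    simp only [Finset.univ_unique, Finset.sum_singleton]
    refine Finset.sum_congr rfl fun F _ => ?_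
    simp [Fin.last]
  | succ x ih =>
    rw [columns, LinearMap.comp_apply, LinearMap.comp_apply, LinearMap.comp_apply, ← ih, sum_snoc,
      Finset.sum_comm]
    refine Finset.sum_congr rfl fun e _ => ?_
    simp only [← sum_column, Finset.mul_sum]
    conv_lhs => enter [2, a]; rw [sum_snoc]
    conv_lhs => enter [2, a]; rw [Finset.sum_comm]
    rw [Finset.sum_comm]
    refine Finset.sum_congr rfl fun f _ => Finset.sum_congr rfl fun a _ =>
      Finset.sum_congr rfl fun g _ => ?_
    have h0 : (Fin.snoc f g : Fin (x + 2) → Fin y → Leg q) 0 = f 0 := by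
      rw [← Fin.castSucc_zero, Fin.snoc_castSucc]
    rw [Fin.prod_univ_castSucc, Fin.prod_univ_castSucc, Fin.prod_univ_castSucc]
    simp only [Fin.snoc_castSucc, Fin.snoc_last, Fin.succ_castSucc, Fin.succ_last, h0,
      Fin.val_castSucc, Fin.val_last]
    ring

/-- The network `w` as a composition of columns. -/
theorem w_eq_columns (q k x y : ℕ) : w q k x y =
    columns y (fun i => if i < k then flat else circ) (fun i => if i + 1 = x then flat else circ) x
      (fun F : Fin y → Leg q => ∏ j, circ (F j)) := by
  rw [← sum_network]
  simp only [w, ite_apply]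

end Network

/-! ### Evaluation of the rectangular network -/

section Rectangle

variable {q y : ℕ}

/-- The slots `k` with `a ≤ k < b`. -/
def slots (n a b : ℕ) : Set (Fin n) := {k | a ≤ (k : ℕ) ∧ (k : ℕ) < b}

theorem mem_slots {n a b : ℕ} {k : Fin n} : k ∈ slots n a b ↔ a ≤ (k : ℕ) ∧ (k : ℕ) < b := Iff.rfl

theorem slots_self (n a : ℕ) : slots n a a = ∅ := by
  ext k
  simp only [mem_slots, Set.mem_empty_iff_false, iff_false]
  omega

/-- The probability carried by a left boundary at the `m`-th vertex of the cut through column `i`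
above its first `j` gates. -/
noncomputable def cutLeft (q i j m : ℕ) : ℝ :=
  if m ≤ j then tail q (i + 1) m else tail q i (m - 1)

/-- The probability carried by a right boundary at the `m`-th vertex of the cut through column `i`
above its first `j` gates. -/
noncomputable def cutRight (q i j m : ℕ) : ℝ :=
  if m ≤ j then rightTail q (i + 1) m else rightTail q i (m - 1)

/-- The value of the partial network with free legs in the slots `a ≤ k < b` above the first `j`
gates of column `i`. -/
noncomputable def cutValue (q i j a b : ℕ) : ℝ :=
  1 + (q - 1) * (cutLeft q i j b * cutRight q i j a -
    q ^ (b - a) * (cutLeft q i j a * cutRight q i j b))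

theorem cutValue_self (q i j a : ℕ) : cutValue q i j a a = 1 := by
  rw [cutValue, Nat.sub_self]
  ring

theorem cutLeft_succ_of_ne {i j m : ℕ} (hm : m ≠ j + 1) :
    cutLeft q i (j + 1) m = cutLeft q i j m := by
  rw [cutLeft, cutLeft]
  by_cases h : m ≤ j
  · rw [if_pos h, if_pos (by omega)]
  · rw [if_neg h, if_neg (by omega)]

theorem cutRight_succ_of_ne {i j m : ℕ} (hm : m ≠ j + 1) :
    cutRight q i (j + 1) m = cutRight q i j m := by
  rw [cutRight, cutRight]
  by_cases h : m ≤ j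
  · rw [if_pos h, if_pos (by omega)]
  · rw [if_neg h, if_neg (by omega)]

/-- Gate `j` replaces the vertex `(i, j)` of the cut by `(i + 1, j + 1)`; the neighbours `(i + 1,
j)` and `(i, j + 1)` are the vertices numbered `j` and `j + 2`. -/
theorem cutLeft_succ (hq : 2 ≤ q) (i j : ℕ) : cutLeft q i (j + 1) (j + 1) =
    q / (1 + q) * cutLeft q i j j + 1 / (1 + q) * cutLeft q i j (j + 2) := by
  rw [cutLeft, cutLeft, cutLeft, if_pos le_rfl, if_pos le_rfl, if_neg (by omega),
    tail_rec hq (by omega)]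
  have h1 : ((j + 1 : ℕ) : ℤ) - 1 = j := by omega
  have h2 : ((j + 2 : ℕ) : ℤ) - 1 = ((j + 1 : ℕ) : ℤ) := by omega
  have h3 : ((i : ℤ) + 1) - 1 = i := by omega
  rw [h1, h2, h3]

theorem cutRight_succ (hq : 2 ≤ q) (i j : ℕ) : cutRight q i (j + 1) (j + 1) =
    q / (1 + q) * cutRight q i j (j + 2) + 1 / (1 + q) * cutRight q i j j := by
  rw [cutRight, cutRight, cutRight, if_pos le_rfl, if_pos le_rfl, if_neg (by omega),
    rightTail_rec hq (by omega)]
  have h1 : ((j + 1 : ℕ) : ℤ) - 1 = j := by omega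
  have h2 : ((j + 2 : ℕ) : ℤ) - 1 = ((j + 1 : ℕ) : ℤ) := by omega
  have h3 : ((i : ℤ) + 1) - 1 = i := by omega
  rw [h1, h2, h3]

/-- The determinant argument of `ringRun_agree_arc`, with `ψ` standing for everything below the
column. Slots are numbered towards the upper left, so `b` is the left end and `a` the right end. The
additive `1` in `cutValue` survives because the two step weights add up to `1`. -/
theorem apply_colRun_agree (hq : 2 ≤ q) {ψ : ((Fin (y + 1) → Leg q) → ℝ) →ₗ[ℝ] ℝ} {c : ℝ} {i : ℕ}
    (h0 : ∀ a b, a ≤ b → b ≤ y + 1 → ψ (agree ℝ (slots (y + 1) a b)) = c * cutValue q i 0 a b)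
    {j : ℕ} (hj : j ≤ y) {a b : ℕ} (hab : a ≤ b) (hb : b ≤ y + 1) :
    ψ (colRun q y j (agree ℝ (slots (y + 1) a b))) = c * cutValue q i j a b := by
  have hq0 : (q : ℝ) ≠ 0 := by
    have : q ≠ 0 := by omega
    exact_mod_cast this
  have hq2 : (1 : ℝ) + q ≠ 0 := by positivity
  induction j generalizing a b with
  | zero => rw [colRun_zero]; exact h0 a b hab hb
  | succ j ih =>
    have ih := @ih (by omega)
    rw [colRun_succ (by omega : j < y), Module.End.mul_apply]
    set l : Fin (y + 1) := Fin.succ ⟨j, by omega⟩ with hl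
    set r : Fin (y + 1) := Fin.castSucc ⟨j, by omega⟩ with hr
    have hlv : (l : ℕ) = j + 1 := rfl
    have hrv : (r : ℕ) = j := rfl
    have hlr : l ≠ r := by
      intro h
      have := congrArg Fin.val h
      omega
    rcases hab.eq_or_lt with rfl | hab
    · rw [slots_self, avgOp_agree_of_iff hlr (by simp), ← slots_self (y + 1) a, ih le_rfl hb,
        cutValue_self, cutValue_self]
    by_cases hbj : b = j + 1
    · subst hbj
      have h1 : ¬(l ∈ slots (y + 1) a (j + 1) ↔ r ∈ slots (y + 1) a (j + 1)) := by
        rw [mem_slots, mem_slots]; omega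
      have h2 : slots (y + 1) a (j + 1) \ {l, r} = slots (y + 1) a j := by
        ext k
        simp only [Set.mem_sdiff, Set.mem_insert_iff, Set.mem_singleton_iff, mem_slots, Fin.ext_iff]
        omega
      have h3 : slots (y + 1) a (j + 1) ∪ {l, r} = slots (y + 1) a (j + 2) := by
        ext k
        simp only [Set.mem_union, Set.mem_insert_iff, Set.mem_singleton_iff, mem_slots, Fin.ext_iff]
        omega
      obtain ⟨d, rfl⟩ : ∃ d, j = a + d := ⟨j - a, by omega⟩
      rw [avgOp_agree_of_cut hq hlr h1, h2, h3, map_add, map_add, map_smul, map_smul, map_smul,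
        map_smul, smul_eq_mul, smul_eq_mul, ih (by omega) (by omega), ih (by omega) (by omega),
        cutValue, cutValue, cutValue, cutLeft_succ hq, cutRight_succ hq,
        cutLeft_succ_of_ne (by omega), cutRight_succ_of_ne (by omega),
        show a + d - a = d by omega, show a + d + 2 - a = d + 2 by omega,
        show a + d + 1 - a = d + 1 by omega, pow_succ, pow_add]
      field_simp
      ring
    by_cases haj : a = j + 1
    · subst haj
      have h1 : ¬(l ∈ slots (y + 1) (j + 1) b ↔ r ∈ slots (y + 1) (j + 1) b) := by
        rw [mem_slots, mem_slots]; omega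
      have h2 : slots (y + 1) (j + 1) b \ {l, r} = slots (y + 1) (j + 2) b := by
        ext k
        simp only [Set.mem_sdiff, Set.mem_insert_iff, Set.mem_singleton_iff, mem_slots, Fin.ext_iff]
        omega
      have h3 : slots (y + 1) (j + 1) b ∪ {l, r} = slots (y + 1) j b := by
        ext k
        simp only [Set.mem_union, Set.mem_insert_iff, Set.mem_singleton_iff, mem_slots, Fin.ext_iff]
        omega
      obtain ⟨d, rfl⟩ : ∃ d, b = j + 2 + d := ⟨b - (j + 2), by omega⟩
      rw [avgOp_agree_of_cut hq hlr h1, h2, h3, map_add, map_add, map_smul, map_smul, map_smul,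
        map_smul, smul_eq_mul, smul_eq_mul, ih (by omega) (by omega), ih (by omega) (by omega),
        cutValue, cutValue, cutValue, cutLeft_succ hq, cutRight_succ hq,
        cutLeft_succ_of_ne (by omega), cutRight_succ_of_ne (by omega),
        show j + 2 + d - (j + 2) = d by omega, show j + 2 + d - j = d + 2 by omega,
        show j + 2 + d - (j + 1) = d + 1 by omega, pow_succ, pow_add]
      field_simp
      ring
    · have h1 : l ∈ slots (y + 1) a b ↔ r ∈ slots (y + 1) a b := by
        rw [mem_slots, mem_slots]; omega
      rw [avgOp_agree_of_iff hlr h1, ih hab.le hb, cutValue, cutValue, cutLeft_succ_of_ne haj,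
        cutLeft_succ_of_ne hbj, cutRight_succ_of_ne haj, cutRight_succ_of_ne hbj]

theorem circ_eq (s : Leg q) : circ s = 1 / Real.sqrt q * if s.1 = s.2 then 1 else 0 := by
  rw [circ]
  split_ifs <;> simp

theorem sum_circ (hq : 2 ≤ q) : ∑ s : Leg q, circ s = Real.sqrt q := by
  have hq0 : (0 : ℝ) < q := by
    have : 0 < q := by omega
    exact_mod_cast this
  simp only [circ_eq, ← Finset.mul_sum, Fintype.sum_prod_type, Finset.sum_ite_eq, Finset.mem_univ,
    if_true, Finset.sum_const, Finset.card_univ, Fintype.card_fin, nsmul_eq_mul, mul_one]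
  rw [one_div_mul_eq_div, Real.div_sqrt]

theorem agree_congr {W W' : Type*} {S : Set W} {S' : Set W'} {s : W → Leg q} {s' : W' → Leg q}
    (h : (∀ w, w ∉ S → (s w).1 = (s w).2) ↔ ∀ w, w ∉ S' → (s' w).1 = (s' w).2) :
    agree ℝ S s = agree ℝ S' s' := by
  by_cases h1 : ∀ w, w ∉ S → (s w).1 = (s w).2
  · rw [agree, agree, if_pos h1, if_pos (h.1 h1)]
  · rw [agree, agree, if_neg h1, if_neg fun h2 => h1 (h.2 h2)]

/-- Removing slot `0` lowers both ends by one, except an end already at `0`, as truncated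
subtraction does. -/
theorem agree_cons (a b : ℕ) (e : Leg q) (F : Fin y → Leg q) :
    agree ℝ (slots (y + 1) a b) (Fin.cons e F : Fin (y + 1) → Leg q) =
      (if a = 0 ∧ 0 < b ∨ e.1 = e.2 then 1 else 0) * agree ℝ (slots y (a - 1) (b - 1)) F := by
  have hmem : (0 : Fin (y + 1)) ∈ slots (y + 1) a b ↔ a = 0 ∧ 0 < b := by
    simp [mem_slots]
  by_cases h : a = 0 ∧ 0 < b ∨ e.1 = e.2
  · rw [if_pos h, one_mul]
    refine agree_congr ?_
    rw [Fin.forall_fin_succ, hmem]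
    constructor
    · rintro ⟨_, h2⟩ k hk
      refine h2 k fun hk' => hk ?_
      rw [mem_slots, Fin.val_succ] at hk'
      rw [mem_slots]
      omega
    · intro h2
      refine ⟨fun h3 => h.resolve_left h3, fun k hk => h2 k fun hk' => hk ?_⟩
      rw [mem_slots] at hk'
      rw [mem_slots, Fin.val_succ]
      omega
  · rw [if_neg h, zero_mul, agree, if_neg]
    intro h2
    refine h (or_iff_not_imp_left.2 fun h3 => ?_)
    exact h2 0 (by rwa [hmem])

/-- The circle state itself enforces agreement on slot `0`, so it is irrelevant whether the interval
contains that slot. -/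
theorem inlet_circ_agree (hq : 2 ≤ q) (a b : ℕ) :
    inlet circ (agree ℝ (slots (y + 1) a b)) =
      Real.sqrt q • agree (q := q) ℝ (slots y (a - 1) (b - 1)) := by
  funext F
  simp only [inlet, LinearMap.coe_mk, AddHom.coe_mk, agree_cons, Pi.smul_apply, smul_eq_mul]
  rw [← sum_circ hq, Finset.sum_mul]
  refine Finset.sum_congr rfl fun e _ => ?_
  rw [circ]
  split_ifs <;> simp_all

theorem outlet_circ_agree {a b : ℕ} (hb : b ≤ y) :
    outlet circ (agree ℝ (slots y a b)) =
      (1 / Real.sqrt q) • agree (q := q) ℝ (slots (y + 1) a b) := by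
  funext s
  simp only [outlet, LinearMap.coe_mk, AddHom.coe_mk, circ_eq, Pi.smul_apply, smul_eq_mul,
    mul_assoc]
  congr 1
  have hlast : Fin.last y ∉ slots (y + 1) a b := by
    rw [mem_slots, Fin.val_last]
    omega
  by_cases h : (s (Fin.last y)).1 = (s (Fin.last y)).2
  · rw [if_pos h, one_mul]
    refine agree_congr ?_
    rw [Fin.forall_fin_succ']
    exact ⟨fun h2 => ⟨h2, fun _ => h⟩, fun h2 => h2.1⟩
  · rw [if_neg h, zero_mul, agree, if_neg]
    exact fun h2 => h (h2 _ hlast)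

theorem prod_circ (F : Fin y → Leg q) :
    ∏ j, circ (F j) = (1 / Real.sqrt q) ^ y * agree ℝ ∅ F := by
  classical
  simp only [circ_eq, Finset.prod_mul_distrib, Finset.prod_const, Finset.card_univ,
    Fintype.card_fin]
  congr 1
  simp only [agree, Set.mem_empty_iff_false, not_false_eq_true, true_imp_iff]
  rw [Finset.prod_ite_zero]
  simp

theorem sum_prod_circ (hq : 2 ≤ q) (y : ℕ) :
    ∑ F : Fin y → Leg q, ∏ j, circ (F j) = Real.sqrt q ^ y := by
  have := Finset.prod_univ_sum (fun _ : Fin y => (Finset.univ : Finset (Leg q)))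
    fun _ s => circ s
  simpa [sum_circ hq] using this.symm

/-- The lower right legs of the network: a flat state on the first column and circle states on the
others. -/
noncomputable def lowerStates (i : ℕ) : Leg q → ℝ := if i < 1 then flat else circ

/-- The flat state contributes `q²/q = q` on a free slot and `q/q = 1` on a slot where agreement is
required; hence the form `1 + (q - 1) * _` of `cutValue`. A right end at vertex `(0, 0)` must have
value `0`, which `rightTail` provides, whereas `tail q 0 0` is `1`. -/
theorem inlet_flat_agree_start (hq : 2 ≤ q) (t : ℕ → Leg q → ℝ) {a b : ℕ} (hab : a ≤ b) :
    columns y lowerStates t 0 (inlet (lowerStates 0) (agree ℝ (slots (y + 1) a b))) =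
      Real.sqrt q ^ y * cutValue q 0 0 a b := by
  have hq0 : (q : ℝ) ≠ 0 := by
    have : q ≠ 0 := by omega
    exact_mod_cast this
  have hval : cutValue q 0 0 a b = if a = 0 ∧ 0 < b then (q : ℝ) else 1 := by
    rcases hab.eq_or_lt with rfl | hab
    · rw [cutValue_self, if_neg (by omega)]
    · have hb0 : 0 < b := by omega
      by_cases ha : a = 0
      · subst ha
        rw [if_pos ⟨rfl, hb0⟩, cutValue, cutLeft, cutLeft, cutRight, cutRight, if_neg (by omega),
          if_pos le_rfl, if_pos le_rfl]
        simp [tail, rightTail]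
      · rw [if_neg (by omega), cutValue, cutRight, cutRight, if_neg (by omega), if_neg (by omega)]
        simp [rightTail]
  have hsum : ∀ F : Fin y → Leg q, (∏ j, circ (F j)) *
      inlet (lowerStates 0) (agree ℝ (slots (y + 1) a b)) F =
        (∏ j, circ (F j)) * if a = 0 ∧ 0 < b then (q : ℝ) else 1 := by
    intro F
    rw [prod_circ]
    by_cases hF : ∀ k, (F k).1 = (F k).2
    · congr 1
      have h1 : agree ℝ (slots y (a - 1) (b - 1)) F = 1 := by
        simp [agree, hF]
      simp only [inlet, LinearMap.coe_mk, AddHom.coe_mk, agree_cons, h1, lowerStates]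
      by_cases h : a = 0 ∧ 0 < b
      · simp only [h, and_self, true_or, if_true, mul_one, Finset.sum_const, Finset.card_univ,
          Fintype.card_prod, Fintype.card_fin, nsmul_eq_mul, if_pos Nat.zero_lt_one, flat]
        push_cast
        field_simp
      · simp only [h, false_or, mul_one, if_false, if_pos Nat.zero_lt_one, flat]
        rw [← Finset.mul_sum, Fintype.sum_prod_type]
        simp [hq0]
    · have : agree ℝ ∅ F = 0 := by
        simp [agree, hF]
      simp [this]
  simp only [columns, LinearMap.coe_mk, AddHom.coe_mk, hsum]
  rw [← Finset.sum_mul, sum_prod_circ hq, hval]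

/-- Passing to the next column renumbers the vertices by one. Only `a = 0` needs care: along the
lower right edge the left probability is constantly `0` and the right one constantly `1`, so
dropping a vertex there changes nothing, and the altered power of `q` multiplies zero. -/
theorem cutValue_next {i a b : ℕ} (hab : a ≤ b) (hb : b ≤ y + 1) :
    cutValue q (i + 1) 0 a b = cutValue q i y (a - 1) (b - 1) := by
  rcases hab.eq_or_lt with rfl | hab
  · rw [cutValue_self, cutValue_self]
  · by_cases ha : a = 0
    · subst ha
      rw [cutValue, cutValue, cutLeft, cutLeft, cutRight, cutRight, cutLeft, cutLeft, cutRight,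
        cutRight, if_neg (by omega), if_pos le_rfl, if_pos le_rfl, if_neg (by omega),
        if_pos (by omega), if_pos (by omega), if_pos (by omega), if_pos (by omega)]
      have h1 : ((b - 1 : ℕ) : ℤ) = (b : ℤ) - 1 := by omega
      have h2 : ¬((i : ℤ) + 1 ≤ 0) := by omega
      have h3 : ¬((i : ℤ) + 1 + 1 ≤ 0) := by omega
      simp [tail, rightTail, h1, h2, h3]
    · rw [cutValue, cutValue, cutLeft, cutLeft, cutRight, cutRight, cutLeft, cutLeft, cutRight,
        cutRight, if_neg (by omega), if_neg (by omega), if_neg (by omega), if_neg (by omega),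
        if_pos (by omega), if_pos (by omega), if_pos (by omega), if_pos (by omega),
        show b - 1 - (a - 1) = b - a by omega]
      have h1 : ((b - 1 : ℕ) : ℤ) = (b : ℤ) - 1 := by omega
      have h2 : ((a - 1 : ℕ) : ℤ) = (a : ℤ) - 1 := by omega
      rw [h1, h2]
      push_cast
      rfl

/-- From one column to the next, the factor `√q` of the circle inlet cancels the `1/√q` of the
circle outlet. -/
theorem columns_colRun_agree (hq : 2 ≤ q) {t : ℕ → Leg q → ℝ} {i : ℕ} (ht : ∀ k < i, t k = circ)
    {j : ℕ} (hj : j ≤ y) {a b : ℕ} (hab : a ≤ b) (hb : b ≤ y + 1) :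
    columns y lowerStates t i
        (inlet (lowerStates i) (colRun q y j (agree ℝ (slots (y + 1) a b)))) =
      Real.sqrt q ^ y * cutValue q i j a b := by
  have hs : Real.sqrt q ≠ 0 := by
    rw [Real.sqrt_ne_zero']
    have : 0 < q := by omega
    exact_mod_cast this
  induction i generalizing j a b with
  | zero =>
    exact apply_colRun_agree hq (ψ := columns y lowerStates t 0 ∘ₗ inlet (lowerStates 0))
      (fun a b hab _ => inlet_flat_agree_start hq t hab) hj hab hb
  | succ i ih =>
    refine apply_colRun_agree hq
      (ψ := columns y lowerStates t (i + 1) ∘ₗ inlet (lowerStates (i + 1))) ?_ hj hab hb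
    intro a b hab hb
    have hl : lowerStates (q := q) (i + 1) = circ := by
      rw [lowerStates, if_neg (by omega)]
    rw [LinearMap.comp_apply, hl, inlet_circ_agree hq, columns, map_smul, LinearMap.comp_apply,
      LinearMap.comp_apply, LinearMap.comp_apply, ht i (by omega), outlet_circ_agree (by omega),
      map_smul, map_smul, map_smul, ih (fun k hk => ht k (by omega)) le_rfl (by omega) (by omega),
      cutValue_next hab hb, smul_eq_mul, smul_eq_mul]
    field_simp

/-- The rectangular network. -/
theorem w_one_eq (hq : 2 ≤ q) {x y : ℕ} (hx : 1 ≤ x) (hy : 1 ≤ y) :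
    w q 1 x y =
        1 / (q : ℝ) + ((q : ℝ) ^ 2 - 1) / q * (Real.sqrt q / (1 + q)) ^ (2 * x + 2 * y) *
          (A x y (α q) * A (y - 1) x (α q) - A x (y - 1) (α q) * A y x (α q)) := by
  obtain ⟨x, rfl⟩ : ∃ n, x = n + 1 := ⟨x - 1, by omega⟩
  have hs : Real.sqrt q ≠ 0 := by
    rw [Real.sqrt_ne_zero']
    have : 0 < q := by omega
    exact_mod_cast this
  have hq0 : (q : ℝ) ≠ 0 := by
    have : q ≠ 0 := by omega
    exact_mod_cast this
  -- The topmost flat leg leaves the last slot free, so the backward evolution starts from the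
  -- one-slot interval `{y}`.
  have hout : outlet flat (fun F : Fin y → Leg q => ∏ j, circ (F j)) =
      (1 / (q : ℝ) * (1 / Real.sqrt q) ^ y) • agree ℝ (slots (y + 1) y (y + 1)) := by
    funext s
    simp only [outlet, LinearMap.coe_mk, AddHom.coe_mk, prod_circ, flat, Pi.smul_apply,
      smul_eq_mul, ← mul_assoc]
    congr 1
    refine agree_congr ?_
    rw [Fin.forall_fin_succ']
    constructor
    · intro h
      refine ⟨fun k _ => h k (by simp), fun h => ?_⟩
      simp [mem_slots] at h
    · rintro ⟨h, _⟩ k _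
      refine h k ?_
      simp only [mem_slots, Fin.val_castSucc]
      omega
  have ht : ∀ k < x, (fun i => if i + 1 = x + 1 then flat else circ : ℕ → Leg q → ℝ) k = circ := by
    intro k hk
    simp only
    rw [if_neg (by omega)]
  have hval : cutValue q x y y (y + 1) = 1 + (q - 1) * ((1 + q) *
      (q / (1 + q) ^ 2 : ℝ) ^ (x + 1 + y) * (A (x + 1 : ℕ) y (α q) * A (y - 1) (x + 1 : ℕ) (α q) -
        A (x + 1 : ℕ) (y - 1) (α q) * A y (x + 1 : ℕ) (α q))) := by
    have h := tail_det hq (x := (x + 1 : ℕ)) (y := y) (by omega) (by omega)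
    rw [show ((x + 1 : ℕ) : ℤ) + y = ((x + 1 + y : ℕ) : ℤ) by push_cast; ring, zpow_natCast] at h
    rw [← h, cutValue, cutLeft, cutLeft, cutRight, cutRight, if_neg (by omega), if_pos le_rfl,
      if_pos le_rfl, if_neg (by omega), rightTail, rightTail, if_neg (by omega)]
    have h1 : ((y + 1 : ℕ) : ℤ) - 1 = y := by omega
    have h2 : ((x + 1 : ℕ) : ℤ) - 1 = x := by omega
    have h3 : (if (x : ℤ) ≤ 0 then 0 else tail q y x) = tail q y x := by
      split_ifs with h
      · rw [tail, if_neg (by omega), if_pos h]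
      · rfl
    rw [h1, h2, h3, show y + 1 - y = 1 by omega, pow_one]
    push_cast
    ring
  rw [w_eq_columns]
  change columns y lowerStates (fun i => if i + 1 = x + 1 then flat else circ) (x + 1) _ = _
  rw [columns, LinearMap.comp_apply, LinearMap.comp_apply, LinearMap.comp_apply]
  simp only [if_true]
  rw [hout, map_smul, map_smul, map_smul,
    columns_colRun_agree (t := fun i => if i + 1 = x + 1 then flat else circ) hq ht le_rfl
      (by omega) le_rfl, hval, show 2 * (x + 1) + 2 * y = 2 * (x + 1 + y) by ring, sqrt_div_pow,
    smul_eq_mul]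
  have e : 1 / (q : ℝ) * (1 / Real.sqrt q) ^ y * Real.sqrt q ^ y = 1 / q := by
    rw [mul_assoc, ← mul_pow, one_div_mul_cancel hs, one_pow, mul_one]
  rw [← mul_assoc, e]
  field_simp
  ring

end Rectangle

end RPC

theorem mainTheorem3 (q : ℕ) (hq : 2 ≤ q) :
    (∀ (L : ℕ) [NeZero L] (t : ℕ) (Oμ Oν : Matrix (Fin q) (Fin q) ℂ) (x : ℤ),
      Oμ.trace = 0 → Oν.trace = 0 → 1 ≤ t → 2 * t ≤ L → -(L : ℤ) < 2 * x → 2 * x ≤ (L : ℤ) →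
      RPC.avgCorr q L t Oμ Oν x =
        RPC.opSum Oμ * RPC.opSum Oν / (1 - (q : ℂ) ^ (-2 : ℤ)) *
          ((Real.sqrt q / (1 + q) : ℝ) : ℂ) ^ (4 * t) *
          ((RPC.A (t - x + 1) (t + x) (RPC.α q) * RPC.A (t + x - 1) (t - x + 1) (RPC.α q) -
            RPC.A (t - x + 1) (t + x - 1) (RPC.α q) * RPC.A (t + x) (t - x + 1) (RPC.α q) : ℝ) :
              ℂ)) ∧
    (∀ x y : ℕ, 1 ≤ x → 1 ≤ y →
      RPC.w q 1 x y =
        1 / (q : ℝ) + ((q : ℝ) ^ 2 - 1) / q * (Real.sqrt q / (1 + q)) ^ (2 * x + 2 * y) *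
          (RPC.A x y (RPC.α q) * RPC.A (y - 1) x (RPC.α q) -
            RPC.A x (y - 1) (RPC.α q) * RPC.A y x (RPC.α q))) :=
  ⟨fun _ _ _ _ _ _ hμ hν ht htL hx1 hx2 => RPC.avgCorr_eq_opSum hq hμ hν ht htL hx1 hx2,
    fun _ _ hx hy => RPC.w_one_eq hq hx hy⟩
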